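/- Let $\rho>0$ and $m\in\mathbb{N}$, and let $(N(t))_{t\ge0}$ be the Erlang A queue length process with abandonment rate $\eta=1$, i.e. the continuous-time birth–death (Markov) process on $\{0,1,2,\dots\}$ with birth rates $\lambda_n=\rho$ and death rates $\mu_n=n$ for $n\le m$, $\mu_n=m+(n-m)\eta$ for $n>m$ (so that $\mu_n=n$ for all $n$ when $\eta=1$: the $M/M/\infty$ queue with unit service rate). Let $n_0\ge0$ be such that $\mathbb{P}[N(0)=n_0]>0$, and put $p_n(t)=\mathbb{P}[N(t)=n\mid N(0)=n_0]$. For $\theta\in\mathbb{C}$ and $n\ge0$ let $$F_n(\theta)=\frac1{2\pi i}\int_{C_0}\frac{e^{\rho z}}{z^{n+1}(1-z)^{\theta}}\,dz,\qquad G_n(\theta)=\frac1{2\pi i}\int_{C_1}\frac{e^{\rho z}}{z^{n+1}(z-1)^{\theta}}\,dz,$$ with principal branches of the powers, where $C_0$ is a counterclockwise circle about $0$ of radius $r\in(0,1)$, and $C_1$ runs from $-\infty-i\varepsilon$ horizontally to $c-i\varepsilon$, vertically to $c+i\varepsilon$ and horizontally back to $-\infty+i\varepsilon$ ($c>1$,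 $\varepsilon>0$), so that it encircles $z=1$ counterclockwise. Then, for every choice of $r$, $c$, $\varepsilon$: 1. For all $n\ge0$ and all $\theta\in\mathbb{C}$ with $\operatorname{Re}\theta>0$, the Laplace transform $\widehat P_n(\theta)=\int_0^\infty e^{-\theta t}p_n(t)\,dt$ converges absolutely and $$\widehat P_n(\theta)=\frac{\Gamma(\theta)\,n_0!\,e^{-\rho}}{\rho^{n_0+\theta}}\begin{cases}F_{n_0}(\theta)\,G_n(\theta),& n\ge n_0,\\ G_{n_0}(\theta)\,F_n(\theta),& 0\le n\le n_0.\end{cases}$$ 2. For all $n\ge0$ and $t\ge0$, $$p_n(t)=\frac{n_0!\,e^{-\rho}}{\rho^{n_0}}\sum_{k=0}^\infty\frac{\rho^k}{k!}e^{-kt}F_{n_0}(-k)F_n(-k),$$ where the series converges absolutely and, for all integers $n,k\ge0$, $$F_n(-k)=\frac1{2\pi i}\int_{C_0}\frac{(1-z)^k}{z^{n+1}}e^{\rho z}\,dz=\sum_{j=0}^{\min\{k,n\}}\binom kj(-1)^j\frac{\rho^{n-j}}{(n-j)!}.$$ 3. For all $n\ge0$ and $t\ge0$ (with $0^0=1$),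 $$p_n(t)=\rho^n e^{-\rho(1-e^{-t})}\sum_{j=0}^{\min\{n,n_0\}}\binom{n_0}{j}\rho^{-j}e^{-jt}\frac{(1-e^{-t})^{n+n_0-2j}}{(n-j)!}.$$ 4. For all $n\ge0$, $\lim_{t\to\infty}p_n(t)=e^{-\rho}\rho^n/n!$. -/

import Mathlib

open scoped NNReal Topology

noncomputable section

namespace ErlangA

/-- `P t i j` (the probability of being in state `j` after time `t` when starting from `i`) is the
transition function of a birth-death process on `ℕ` with birth rates `birth i` and death rates
`death i`: a stochastic semigroup with the infinitesimal transition probabilities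
`birth i * h + o(h)` for `i → i + 1`, `death i * h + o(h)` for `i → i - 1` (`i ≥ 1`) and
`1 - (birth i + death i) * h + o(h)` for `i → i`, as `h ↓ 0`. -/
structure IsBirthDeathTransition (birth death : ℕ → ℝ) (P : ℝ≥0 → ℕ → ℕ → ℝ) : Prop where
  nonneg : ∀ t i j, 0 ≤ P t i j
  hasSum_one : ∀ t i, HasSum (fun j => P t i j) 1
  zero : ∀ i j, P 0 i j = if i = j then 1 else 0
  chapman_kolmogorov : ∀ s t i j, HasSum (fun k => P s i k * P t k j) (P (s + t) i j)
  rate_up : ∀ i, Filter.Tendsto (fun h : ℝ≥0 => P h i (i + 1) / (h : ℝ)) (𝓝[>] 0) (𝓝 (birth i))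
  rate_down : ∀ i,
    Filter.Tendsto (fun h : ℝ≥0 => P h (i + 1) i / (h : ℝ)) (𝓝[>] 0) (𝓝 (death (i + 1)))
  rate_stay : ∀ i,
    Filter.Tendsto (fun h : ℝ≥0 => (1 - P h i i) / (h : ℝ)) (𝓝[>] 0) (𝓝 (birth i + death i))

/-- `N` is, under `μ`, a (time-homogeneous, continuous-time) birth-death process with the given
birth and death rates, with an arbitrary initial law. The last clause is the Markov property:
given `N s = i` and any finitely many values of `N` at times before `s`, the conditional
probability of `N (s + h) = j` is `P h i j`. -/
def IsBirthDeathProcess {Ω : Type*} [MeasurableSpace Ω] (μ : MeasureTheory.Measure Ω)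
    (birth death : ℕ → ℝ) (N : ℝ≥0 → Ω → ℕ) : Prop :=
  (∀ t, Measurable (N t)) ∧
  ∃ P : ℝ≥0 → ℕ → ℕ → ℝ, IsBirthDeathTransition birth death P ∧
    ∀ (K : ℕ) (τ : Fin K → ℝ≥0) (x : Fin K → ℕ) (s h : ℝ≥0) (i j : ℕ), (∀ l, τ l ≤ s) →
      μ.real {ω | (∀ l, N (τ l) ω = x l) ∧ N s ω = i ∧ N (s + h) ω = j} =
        μ.real {ω | (∀ l, N (τ l) ω = x l) ∧ N s ω = i} * P h i j

/-- Death rates of the Erlang A model with `m` servers, unit service rate and abandonment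
rate `η`. -/
def deathRate (m : ℕ) (η : ℝ) (n : ℕ) : ℝ :=
  if n ≤ m then (n : ℝ) else m + ((n : ℝ) - m) * η

/-- The Erlang A queue length process with `m` servers, arrival rate `ρ`, unit service rate and
abandonment rate `η`. -/
def IsErlangA {Ω : Type*} [MeasurableSpace Ω] (μ : MeasureTheory.Measure Ω)
    (m : ℕ) (η ρ : ℝ) (N : ℝ≥0 → Ω → ℕ) : Prop :=
  IsBirthDeathProcess μ (fun _ => ρ) (deathRate m η) N

/-- `p_n(t) = Prob[N(t) = n | N(0) = n₀]`, for `t ≥ 0`. -/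
def p {Ω : Type*} [MeasurableSpace Ω] (μ : MeasureTheory.Measure Ω) (N : ℝ≥0 → Ω → ℕ)
    (n₀ n : ℕ) (t : ℝ) : ℝ :=
  (ProbabilityTheory.cond μ {ω | N 0 ω = n₀}).real {ω | N t.toNNReal ω = n}

/-- The function `F_n(θ)`: the integral over the circle `C₀` of radius `r` about `0`. -/
def F (ρ r : ℝ) (n : ℕ) (θ : ℂ) : ℂ :=
  (2 * Real.pi * Complex.I)⁻¹ *
    ∮ z in C(0, r), Complex.exp (ρ * z) / (z ^ (n + 1) * (1 - z) ^ θ)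

/-- The integral of `f` along the contour that runs from `-∞ - iε` along a horizontal ray to
`c - iε`, along a vertical segment to `c + iε`, and along a horizontal ray back to `-∞ + iε`. -/
def loopIntegral (c ε : ℝ) (f : ℂ → ℂ) : ℂ :=
  (∫ x : ℝ in Set.Iic c, f (x - ε * Complex.I)) +
    Complex.I * (∫ y : ℝ in (-ε)..ε, f (c + y * Complex.I)) -
    ∫ x : ℝ in Set.Iic c, f (x + ε * Complex.I)

/-- The function `G_n(θ)`: the integral over the loop `C₁`, which encircles `1` (for `c > 1`). -/
def G (ρ c ε : ℝ) (n : ℕ) (θ : ℂ) : ℂ :=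
  (2 * Real.pi * Complex.I)⁻¹ *
    loopIntegral c ε fun z => Complex.exp (ρ * z) / (z ^ (n + 1) * (z - 1) ^ θ)

end ErlangA

end

noncomputable section

namespace ErlangA

open Filter Set MeasureTheory

/-! ### The Kolmogorov backward equation -/

namespace IsBirthDeathTransition

variable {birth death : ℕ → ℝ} {P : ℝ≥0 → ℕ → ℕ → ℝ}

/-! For η = 1 each of the n customers leaves independently at rate 1. Of the initial customers a
binomial number with parameter q = e^{-t} survives, and the arrivals still present form an
independent Poisson number with mean ρ(1 - q). This law is `binomPoisson`; it solves the backward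
equation, and by a maximum principle (`nonpos_of_backward`) a bounded solution is determined by its
initial values. Hence `p_eq_binomPoisson`, which gives the finite sum by expansion and the limit by
q → 0.

The spectral series is a bilinear generating function for the Charlier polynomials F_n(-k), proved
in `hasSum_charlier` by induction from their recurrences.

For the Laplace transform, the transformed backward equation is a three-term recurrence in the
initial state, homogeneous below the target state. F_i(θ) solves it up to the factor i!/ρ^i
(`succ_mul_F_succ`), so only the initial state 0 remains (`resolvent_eq_of_le`). There the
substitution y = ρe^{-t} turns the transform into a convolution of y^{θ-1}e^y with y^n/n!, whose
Laplace transform in ρ is Γ(θ)(z-1)^{-θ}z^{-n-1}. Fourier inversion on Re z = c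
(`resolvent_zero_left`) and a contour deformation produce G_n. Detailed balance covers target states
below the initial one. -/

lemma le_one (hP : IsBirthDeathTransition birth death P) (t i j) : P t i j ≤ 1 :=
  le_hasSum (hP.hasSum_one t i) j fun _ _ => hP.nonneg _ _ _

lemma sum_mul_le (hP : IsBirthDeathTransition birth death P) (S : Finset ℕ) (h t : ℝ≥0)
    (i j : ℕ) : ∑ k ∈ S, P h i k * P t k j ≤ P (h + t) i j :=
  sum_le_hasSum S (fun _ _ => mul_nonneg (hP.nonneg _ _ _) (hP.nonneg _ _ _))
    (hP.chapman_kolmogorov h t i j)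

/-- States outside `S` contribute at most the mass that the first step puts there, because `P t k j
≤ 1`. -/
lemma sub_sum_mul_le (hP : IsBirthDeathTransition birth death P) (S : Finset ℕ) (h t : ℝ≥0)
    (i j : ℕ) : P (h + t) i j - ∑ k ∈ S, P h i k * P t k j ≤ 1 - ∑ k ∈ S, P h i k := by
  have := sum_le_hasSum S (fun k _ => by
    have := mul_le_mul_of_nonneg_left (hP.le_one t k j) (hP.nonneg h i k)
    rw [mul_one] at this
    exact sub_nonneg.2 this) ((hP.hasSum_one h i).sub (hP.chapman_kolmogorov h t i j))
  rw [Finset.sum_sub_distrib] at this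
  linarith

/-- Conditioning on the state at time `h`, the change is a gain from paths found elsewhere minus the
loss `(1 - P h i i) * P t i j`. Both lie between 0 and `1 - P h i i`, so the modulus of continuity
is uniform in `t`. -/
lemma abs_sub_le (hP : IsBirthDeathTransition birth death P) (h t : ℝ≥0) (i j : ℕ) :
    |P (h + t) i j - P t i j| ≤ 1 - P h i i := by
  have h1 := hP.sum_mul_le {i} h t i j
  have h2 := hP.sub_sum_mul_le {i} h t i j
  simp only [Finset.sum_singleton] at h1 h2
  have h3 := mul_nonneg (sub_nonneg.2 (hP.le_one h i i)) (hP.nonneg t i j)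
  have h4 := mul_nonneg (sub_nonneg.2 (hP.le_one h i i)) (sub_nonneg.2 (hP.le_one t i j))
  rw [abs_le]
  constructor <;> nlinarith

lemma tendsto_one_sub_diag (hP : IsBirthDeathTransition birth death P) (i : ℕ) :
    Tendsto (fun h : ℝ≥0 => 1 - P h i i) (𝓝 0) (𝓝 0) := by
  have h1 : Tendsto (fun h : ℝ≥0 => 1 - P h i i) (𝓝[>] 0) (𝓝 0) := by
    have h2 : Tendsto (fun h : ℝ≥0 => (h : ℝ)) (𝓝[>] 0) (𝓝 0) :=
      (NNReal.continuous_coe.tendsto 0).mono_left nhdsWithin_le_nhds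
    have h3 := (hP.rate_stay i).mul h2
    rw [mul_zero] at h3
    refine h3.congr' ?_
    filter_upwards [self_mem_nhdsWithin] with h hh
    have : (h : ℝ) ≠ 0 := by exact_mod_cast (ne_of_gt hh)
    field_simp
  have h4 : (𝓝 (0 : ℝ≥0)) = 𝓝[>] 0 ⊔ pure 0 := by
    rw [sup_comm, ← nhdsNE_sup_pure, sup_comm]
    congr 2
    ext x
    simp [pos_iff_ne_zero]
  rw [h4]
  refine h1.sup ?_
  rw [tendsto_pure_left]
  intro s hs
  simpa [hP.zero] using mem_of_mem_nhds hs

lemma continuous (hP : IsBirthDeathTransition birth death P) (i j : ℕ) :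
    Continuous fun t : ℝ => P t.toNNReal i j := by
  have key : ∀ a b : ℝ≥0, |P a i j - P b i j| ≤ 1 - P (a - b + (b - a)) i i := by
    intro a b
    rcases le_total a b with hab | hab
    · have := hP.abs_sub_le (b - a) a i j
      rw [tsub_add_cancel_of_le hab, abs_sub_comm] at this
      rwa [tsub_eq_zero_of_le hab, zero_add]
    · have := hP.abs_sub_le (a - b) b i j
      rw [tsub_add_cancel_of_le hab] at this
      rwa [tsub_eq_zero_of_le hab, add_zero]
  refine Continuous.comp (g := fun t : ℝ≥0 => P t i j) ?_ continuous_real_toNNReal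
  rw [continuous_iff_continuousAt]
  intro b
  rw [ContinuousAt, tendsto_iff_norm_sub_tendsto_zero]
  have hc : Tendsto (fun a : ℝ≥0 => a - b + (b - a)) (𝓝 b) (𝓝 0) := by
    have : Continuous fun a : ℝ≥0 => a - b + (b - a) := by fun_prop
    simpa using this.tendsto b
  exact squeeze_zero (fun _ => norm_nonneg _) (fun a => key a b)
    ((hP.tendsto_one_sub_diag i).comp hc)

/-- The error of the nearest-neighbour approximation is nonnegative and at most the probability of
being outside `{i - 1, i, i + 1}` after time `h`. The function `d` is the probability of one step
down, taken as 0 at `i = 0`, where truncated `i - 1` would count state 0 twice. -/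
lemma exists_remainder (hP : IsBirthDeathTransition birth death P) (h0 : death 0 = 0) (i : ℕ) :
    ∃ d : ℝ≥0 → ℝ, Tendsto (fun h : ℝ≥0 => d h / (h : ℝ)) (𝓝[>] 0) (𝓝 (death i)) ∧
      ∀ (h t : ℝ≥0) (j : ℕ),
        0 ≤ P (h + t) i j - P t i j - (P h i (i + 1) * P t (i + 1) j - (1 - P h i i) * P t i j +
          d h * P t (i - 1) j) ∧
        P (h + t) i j - P t i j - (P h i (i + 1) * P t (i + 1) j - (1 - P h i i) * P t i j +
          d h * P t (i - 1) j) ≤ (1 - P h i i) - P h i (i + 1) - d h := by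
  rcases i with _ | i
  · refine ⟨0, by simp [h0], fun h t j => ?_⟩
    have h1 := hP.sum_mul_le {0, 1} h t 0 j
    have h2 := hP.sub_sum_mul_le {0, 1} h t 0 j
    simp only [Finset.sum_pair zero_ne_one] at h1 h2
    simp only [Pi.zero_apply, zero_add]
    constructor <;> linarith
  · refine ⟨fun h => P h (i + 1) i, hP.rate_down i, fun h t j => ?_⟩
    have h1 := hP.sum_mul_le {i, i + 1, i + 1 + 1} h t (i + 1) j
    have h2 := hP.sub_sum_mul_le {i, i + 1, i + 1 + 1} h t (i + 1) j
    rw [Finset.sum_insert (by simp; omega), Finset.sum_pair (by simp)] at h1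
    rw [Finset.sum_insert (by simp; omega), Finset.sum_pair (by simp), Finset.sum_insert (by simp; omega),
      Finset.sum_pair (by simp)] at h2
    simp only [Nat.add_sub_cancel]
    constructor <;> linarith

/-- The rates up and down exhaust the rate of leaving `i`, so the remainder is `o(h)` and no limit
has to be exchanged with the infinite Chapman–Kolmogorov sum. -/
lemma hasDerivWithinAt (hP : IsBirthDeathTransition birth death P) (h0 : death 0 = 0) (i j : ℕ)
    {t : ℝ} (ht : 0 ≤ t) :
    HasDerivWithinAt (fun t : ℝ => P t.toNNReal i j)
      (birth i * (P t.toNNReal (i + 1) j - P t.toNNReal i j) +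
        death i * (P t.toNNReal (i - 1) j - P t.toNNReal i j)) (Ici t) t := by
  obtain ⟨d, hd, hr⟩ := hP.exists_remainder h0 i
  rw [← hasDerivWithinAt_Ioi_iff_Ici, hasDerivWithinAt_iff_tendsto_slope' self_notMem_Ioi]
  set T := t.toNNReal
  have main : Tendsto (fun h : ℝ≥0 => (P (h + T) i j - P T i j) / (h : ℝ)) (𝓝[>] 0)
      (𝓝 (birth i * (P T (i + 1) j - P T i j) + death i * (P T (i - 1) j - P T i j))) := by
    have hz : Tendsto (fun h : ℝ≥0 => (P (h + T) i j - P T i j - (P h i (i + 1) * P T (i + 1) j -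
        (1 - P h i i) * P T i j + d h * P T (i - 1) j)) / (h : ℝ)) (𝓝[>] 0) (𝓝 0) := by
      have hu := ((hP.rate_stay i).sub (hP.rate_up i)).sub hd
      rw [show birth i + death i - birth i - death i = 0 by ring] at hu
      refine squeeze_zero (fun h => div_nonneg (hr h T j).1 h.2) (fun h => ?_) hu
      rw [← sub_div, ← sub_div]
      exact div_le_div_of_nonneg_right (hr h T j).2 h.2
    have := hz.add ((((hP.rate_up i).mul_const (P T (i + 1) j)).sub
      ((hP.rate_stay i).mul_const (P T i j))).add (hd.mul_const (P T (i - 1) j)))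
    convert this using 2
    · ring
    · ring
  have hm : Tendsto (fun y : ℝ => (y - t).toNNReal) (𝓝[>] t) (𝓝[>] 0) := by
    refine tendsto_nhdsWithin_iff.2 ⟨?_, ?_⟩
    · have : Continuous fun y : ℝ => (y - t).toNNReal := by fun_prop
      simpa using (this.tendsto t).mono_left nhdsWithin_le_nhds
    · filter_upwards [self_mem_nhdsWithin] with y hy
      simpa using hy
  refine (main.comp hm).congr' ?_
  filter_upwards [self_mem_nhdsWithin] with y hy
  have hy' : 0 ≤ y - t := sub_nonneg.2 (le_of_lt hy)
  have e : (y - t).toNNReal + T = y.toNNReal := by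
    rw [← Real.toNNReal_add hy' ht, sub_add_cancel]
  simp only [Function.comp_apply, e, Real.coe_toNNReal _ hy', slope_def_field]
  rfl

lemma hasDerivAt (hP : IsBirthDeathTransition birth death P) (h0 : death 0 = 0) (i j : ℕ)
    {t : ℝ} (ht : 0 < t) :
    HasDerivAt (fun t : ℝ => P t.toNNReal i j)
      (birth i * (P t.toNNReal (i + 1) j - P t.toNNReal i j) +
        death i * (P t.toNNReal (i - 1) j - P t.toNNReal i j)) t := by
  set g : ℝ → ℝ := fun t => birth i * (P t.toNNReal (i + 1) j - P t.toNNReal i j) +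
        death i * (P t.toNNReal (i - 1) j - P t.toNNReal i j)
  have hg : Continuous g := by
    have h := hP.continuous i j
    exact (((hP.continuous (i + 1) j).sub h).const_mul _).add
      (((hP.continuous (i - 1) j).sub h).const_mul _)
  have hF : ∀ x, HasDerivAt (fun y => P (0 : ℝ).toNNReal i j + ∫ s in (0 : ℝ)..y, g s) (g x) x :=
    fun x => (intervalIntegral.integral_hasDerivAt_right (hg.intervalIntegrable _ _)
      (hg.stronglyMeasurableAtFilter _ _) hg.continuousAt).const_add _
  -- The right derivative is continuous, so the function coincides with its integral and is
  -- differentiable from both sides.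
  have heq := eq_of_has_deriv_right_eq (a := 0) (b := t + 1)
    (fun x hx => hP.hasDerivWithinAt h0 i j hx.1) (fun x _ => (hF x).hasDerivWithinAt)
    (hP.continuous i j).continuousOn (fun x _ => (hF x).continuousAt.continuousWithinAt) (by simp)
  refine (hF t).congr_of_eventuallyEq ?_
  filter_upwards [Icc_mem_nhds ht (lt_add_one t)] with y hy using heq y hy

end IsBirthDeathTransition

/-! ### Uniqueness of bounded solutions of the backward equation -/

/-- Maximum principle with the barrier δ(i + 1 + (ρ + 1)t). The generator maps i + 1 to ρ - i ≤ ρ,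
while the barrier grows at rate δ(ρ + 1), so it is a strict supersolution. It exceeds `B` for large
i, so only finitely many states can touch it. At a first contact time the left slope of the
difference is nonnegative, yet the equation makes it at most -δ. -/
lemma nonpos_of_backward {ρ B : ℝ} (hρ : 0 < ρ) {w : ℕ → ℝ → ℝ} (hc : ∀ i, Continuous (w i))
    (hd : ∀ i t, 0 < t →
      HasDerivAt (w i) (ρ * (w (i + 1) t - w i t) + i * (w (i - 1) t - w i t)) t)
    (hB : ∀ i t, 0 ≤ t → w i t ≤ B) (h0 : ∀ i, w i 0 ≤ 0) (i : ℕ) {t : ℝ} (ht : 0 ≤ t) :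
    w i t ≤ 0 := by
  suffices H : ∀ δ > 0, w i t ≤ δ * (i + 1 + (ρ + 1) * t) by
    have hpos : 0 < (i : ℝ) + 1 + (ρ + 1) * t := by positivity
    refine le_of_forall_pos_le_add fun e he => ?_
    have := H (e / (i + 1 + (ρ + 1) * t)) (by positivity)
    rw [div_mul_cancel₀ _ hpos.ne'] at this
    simpa using this
  intro δ hδ
  by_contra! hlt
  obtain ⟨N₀, hN₀⟩ := exists_nat_gt (B / δ)
  -- Beyond `N` the barrier exceeds `B`; including `i` puts the supposed violation at time `t` into
  -- `S`.
  set N := max N₀ i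
  have hN : B < δ * (N : ℝ) := by
    rw [div_lt_iff₀ hδ] at hN₀
    have : (N₀ : ℝ) ≤ N := by exact_mod_cast le_max_left _ _
    nlinarith
  set v : ℕ → ℝ → ℝ := fun k s => w k s - δ * (k + 1 + (ρ + 1) * s)
  have hvc : ∀ k, Continuous (v k) := fun k => by
    have := hc k
    fun_prop
  have hbig : ∀ k s, 0 ≤ s → N < k → v k s < 0 := by
    intro k s hs hk
    have h1 := hB k s hs
    have h2 : (N : ℝ) ≤ k := by exact_mod_cast hk.le
    have h3 : 0 ≤ (ρ + 1) * s := by positivity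
    simp only [v]
    nlinarith
  set S : Set ℝ := Icc 0 t ∩ ⋃ k ∈ Finset.range (N + 1), {s | 0 ≤ v k s}
  have hSc : IsClosed S := isClosed_Icc.inter <|
    isClosed_biUnion_finset fun k _ => isClosed_le continuous_const (hvc k)
  have hSne : S.Nonempty := by
    refine ⟨t, ⟨ht, le_rfl⟩, ?_⟩
    simp only [mem_iUnion]
    refine ⟨i, by simp [N], ?_⟩
    simp only [mem_ofPred_eq, v]
    linarith
  have hSb : BddBelow S := ⟨0, fun s hs => hs.1.1⟩
  set t₀ := sInf S
  have ht₀ : t₀ ∈ S := hSc.csInf_mem hSne hSb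
  obtain ⟨⟨ht₀0, ht₀t⟩, hk⟩ := ht₀
  simp only [mem_iUnion] at hk
  obtain ⟨k, hkN, hk⟩ := hk
  have hbefore : ∀ s, 0 ≤ s → s < t₀ → ∀ l, v l s < 0 := by
    intro s hs hst l
    rcases lt_or_ge N l with hl | hl
    · exact hbig l s hs hl
    · by_contra! hv
      refine absurd (csInf_le hSb (a := s) ⟨⟨hs, by linarith⟩, ?_⟩) (not_le.2 hst)
      simp only [mem_iUnion]
      exact ⟨l, by simpa [Nat.lt_succ_iff] using hl, hv⟩
  have htpos : 0 < t₀ := by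
    rcases ht₀0.eq_or_lt with h | h
    · exfalso
      have h1 := h0 k
      have hk' : 0 ≤ w k t₀ - δ * (k + 1 + (ρ + 1) * t₀) := hk
      rw [← h] at hk'
      have : 0 < δ * ((k : ℝ) + 1 + (ρ + 1) * 0) := by positivity
      linarith
    · exact h
  have hleft : ∀ᶠ s in 𝓝[<] t₀, 0 ≤ s ∧ s < t₀ := by
    filter_upwards [Ico_mem_nhdsLT htpos] with s hs using hs
  have hle : ∀ l, v l t₀ ≤ 0 := fun l =>
    le_of_tendsto ((hvc l).continuousAt.tendsto.mono_left nhdsWithin_le_nhds)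
      (hleft.mono fun s hs => (hbefore s hs.1 hs.2 l).le)
  have hk0 : v k t₀ = 0 := le_antisymm (hle k) hk
  have hderiv := (hd k t₀ htpos).sub ((((hasDerivAt_id t₀).const_mul (ρ + 1)).const_add
    ((k : ℝ) + 1)).const_mul δ)
  have hnonneg := ge_of_tendsto ((hasDerivAt_iff_tendsto_slope.1 hderiv).mono_left
    (nhdsLT_le_nhdsNE _)) (hleft.mono fun s hs => by
      have h1 := hbefore s hs.1 hs.2 k
      rw [slope_def_field]
      exact div_nonneg_of_nonpos (by
        change v k s - v k t₀ ≤ 0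
        linarith) (by linarith [hs.2]))
  -- At contact the neighbours lie below the barrier, whose spatial increments are ±δ.
  have h1 := hle (k + 1)
  have h2 := hle (k - 1)
  simp only [v] at h1 h2 hk0
  push_cast at h1
  have h3 : (k : ℝ) * (w (k - 1) t₀ - w k t₀) ≤ 0 := by
    rcases k with _ | k
    · simp
    · refine mul_nonpos_of_nonneg_of_nonpos (by positivity) ?_
      simp only [Nat.add_sub_cancel] at h2 ⊢
      push_cast at hk0
      nlinarith
  have h4 : ρ * (w (k + 1) t₀ - w k t₀) ≤ ρ * δ := by
    refine mul_le_mul_of_nonneg_left ?_ hρ.le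
    linarith
  linarith

/-! ### The transition function of the `M/M/∞` queue -/

/-- The sequence `a` shifted by one, with a zero in front. -/
def prev {R : Type*} [Zero R] (a : ℕ → R) : ℕ → R
  | 0 => 0
  | n + 1 => a n

@[simp] lemma prev_zero {R : Type*} [Zero R] (a : ℕ → R) : prev a 0 = 0 := rfl

@[simp] lemma prev_succ {R : Type*} [Zero R] (a : ℕ → R) (n : ℕ) : prev a (n + 1) = a n := rfl

/-- The sequence obtained from `v` by applying `i` times the operator `a + b • prev`. -/
def binomShift (a b : ℝ) (v : ℕ → ℝ) : ℕ → ℕ → ℝ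
  | 0 => v
  | i + 1 => fun n => a * binomShift a b v i n + b * prev (binomShift a b v i) n

/-- On generating functions each step multiplies by a + bX, so the binomial theorem applies. -/
lemma binomShift_eq_sum (a b : ℝ) (v : ℕ → ℝ) (i n : ℕ) :
    binomShift a b v i n = ∑ j ∈ Finset.range (min n i + 1),
      (i.choose j : ℝ) * b ^ j * a ^ (i - j) * v (n - j) := by
  have hgen : PowerSeries.mk (binomShift a b v i) =
      (PowerSeries.C b * PowerSeries.X + PowerSeries.C a) ^ i * PowerSeries.mk v := by
    induction i with
    | zero => simp [binomShift]
    | succ i ih =>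
      rw [pow_succ', mul_assoc, ← ih]
      ext n
      rw [add_mul, mul_assoc, map_add, PowerSeries.coeff_C_mul, PowerSeries.coeff_C_mul]
      rcases n with _ | n
      · simp [binomShift]
      · simp [binomShift, PowerSeries.coeff_succ_X_mul]
        ring
  have hcoeff := congrArg (PowerSeries.coeff n) hgen
  rw [PowerSeries.coeff_mk, add_pow, Finset.sum_mul, map_sum] at hcoeff
  have hterm : ∀ j, PowerSeries.coeff n ((PowerSeries.C b * PowerSeries.X) ^ j *
      PowerSeries.C a ^ (i - j) * ((i.choose j : ℕ) : PowerSeries ℝ) * PowerSeries.mk v) =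
      if j ≤ n then (i.choose j : ℝ) * b ^ j * a ^ (i - j) * v (n - j) else 0 := by
    intro j
    have : (PowerSeries.C b * PowerSeries.X) ^ j * PowerSeries.C a ^ (i - j) *
        ((i.choose j : ℕ) : PowerSeries ℝ) * PowerSeries.mk v =
        PowerSeries.C (b ^ j * a ^ (i - j) * i.choose j) *
          (PowerSeries.X ^ j * PowerSeries.mk v) := by
      simp only [map_mul, map_pow, map_natCast]
      ring
    rw [this, PowerSeries.coeff_C_mul, PowerSeries.coeff_X_pow_mul']
    split_ifs
    · rw [PowerSeries.coeff_mk]; ring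
    · simp
  rw [hcoeff, Finset.sum_congr rfl fun j _ => hterm j, ← Finset.sum_filter]
  refine Finset.sum_congr ?_ fun _ _ => rfl
  ext j
  simp
  omega

/-- The probability that a binomial variable with parameters `i`, `q` plus an independent Poisson
variable with mean `ρ (1 - q)` equals `n`. -/
def binomPoisson (ρ q : ℝ) : ℕ → ℕ → ℝ :=
  binomShift (1 - q) q fun n => Real.exp (-(ρ * (1 - q))) * (ρ * (1 - q)) ^ n / n.factorial

lemma binomPoisson_zero_left (ρ q : ℝ) (n : ℕ) : binomPoisson ρ q 0 n =
    Real.exp (-(ρ * (1 - q))) * (ρ * (1 - q)) ^ n / n.factorial := rfl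

lemma binomPoisson_succ (ρ q : ℝ) (i n : ℕ) : binomPoisson ρ q (i + 1) n =
    (1 - q) * binomPoisson ρ q i n + q * prev (binomPoisson ρ q i) n := rfl

/-- This is the X^n coefficient of the q-derivative of (1 - q + qX)^i exp(-ρ(1 - q)(1 - X)). The
truncated `i - 1` at `i = 0` is harmless because of the factor `i`. -/
lemma hasDerivAt_binomPoisson (ρ : ℝ) (i n : ℕ) (q : ℝ) :
    HasDerivAt (fun q => binomPoisson ρ q i n)
      (ρ * (binomPoisson ρ q i n - prev (binomPoisson ρ q i) n) +
        i * (prev (binomPoisson ρ q (i - 1)) n - binomPoisson ρ q (i - 1) n)) q := by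
  induction i generalizing n with
  | zero =>
    have h1 : HasDerivAt (fun q : ℝ => ρ * (1 - q)) (-ρ) q := by
      simpa using ((hasDerivAt_id q).const_sub 1).const_mul ρ
    have h2 := (h1.neg.exp.mul (h1.pow n)).div_const (n.factorial : ℝ)
    refine h2.congr_deriv ?_
    rcases n with _ | n
    · simp [binomPoisson_zero_left]
      ring
    · simp only [binomPoisson_zero_left, prev_succ, Nat.factorial_succ, Pi.neg_apply, Nat.add_sub_cancel,
        Nat.cast_zero, zero_mul, add_zero]
      push_cast
      field_simp
      simp
      left
      ring
  | succ i ih =>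
    have hp : HasDerivAt (fun q => prev (binomPoisson ρ q i) n)
        (prev (fun n => ρ * (binomPoisson ρ q i n - prev (binomPoisson ρ q i) n) +
          i * (prev (binomPoisson ρ q (i - 1)) n - binomPoisson ρ q (i - 1) n)) n) q := by
      rcases n with _ | n
      · simpa using hasDerivAt_const q (0 : ℝ)
      · simpa using ih n
    have h1 : HasDerivAt (fun q : ℝ => 1 - q) (-1) q := by
      simpa using (hasDerivAt_id q).const_sub 1
    refine ((h1.mul (ih n)).add ((hasDerivAt_id q).mul hp)).congr_deriv ?_
    simp only [id, Nat.add_sub_cancel]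
    rcases i with _ | i
    · rcases n with _ | n
      · simp [binomPoisson_succ]
        ring
      · simp [binomPoisson_succ]
        ring
    · rcases n with _ | n
      · simp [binomPoisson_succ]
        ring
      · simp [binomPoisson_succ]
        ring

lemma binomPoisson_nonneg {ρ q : ℝ} (hρ : 0 ≤ ρ) (hq : 0 ≤ q) (hq1 : q ≤ 1) (i n : ℕ) :
    0 ≤ binomPoisson ρ q i n := by
  have hs : 0 ≤ 1 - q := sub_nonneg.2 hq1
  induction i generalizing n with
  | zero => rw [binomPoisson_zero_left]; positivity
  | succ i ih =>
    rw [binomPoisson_succ]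
    refine add_nonneg (mul_nonneg hs (ih n)) (mul_nonneg hq ?_)
    rcases n with _ | n
    · exact le_rfl
    · exact ih n

/-- Convex combinations preserve the bound, and boundedness is all that the comparison argument asks
for. -/
lemma binomPoisson_le_one {ρ q : ℝ} (hρ : 0 ≤ ρ) (hq : 0 ≤ q) (hq1 : q ≤ 1) (i n : ℕ) :
    binomPoisson ρ q i n ≤ 1 := by
  have hs : 0 ≤ 1 - q := sub_nonneg.2 hq1
  induction i generalizing n with
  | zero =>
    rw [binomPoisson_zero_left, mul_div_assoc, Real.exp_neg, inv_mul_le_iff₀ (Real.exp_pos _),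
      mul_one]
    exact Real.pow_div_factorial_le_exp _ (mul_nonneg hρ hs) n
  | succ i ih =>
    rw [binomPoisson_succ]
    have : prev (binomPoisson ρ q i) n ≤ 1 := by
      rcases n with _ | n
      · exact zero_le_one
      · exact ih n
    nlinarith [ih n]

lemma binomPoisson_one (ρ : ℝ) (i n : ℕ) :
    binomPoisson ρ 1 i n = if i = n then 1 else 0 := by
  induction i generalizing n with
  | zero => rcases n with _ | n <;> simp [binomPoisson_zero_left]
  | succ i ih => rcases n with _ | n <;> simp [binomPoisson_succ, ih]

lemma continuous_binomPoisson (ρ : ℝ) (i n : ℕ) : Continuous fun q => binomPoisson ρ q i n :=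
  continuous_iff_continuousAt.2 fun q => (hasDerivAt_binomPoisson ρ i n q).continuousAt

lemma binomPoisson_zero_middle (ρ : ℝ) (i n : ℕ) :
    binomPoisson ρ 0 i n = Real.exp (-ρ) * ρ ^ n / n.factorial := by
  induction i with
  | zero => simp [binomPoisson_zero_left]
  | succ i ih => simp [binomPoisson_succ, ih]

/-- Since dq/dt = -q, the identity q(`prev` - 1) = shift in `i` from `binomPoisson_succ` trades
differences in the final state for differences in the initial one. The result is the backward
equation. -/
lemma hasDerivAt_binomPoisson_exp (ρ : ℝ) (i n : ℕ) (t : ℝ) :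
    HasDerivAt (fun t => binomPoisson ρ (Real.exp (-t)) i n)
      (ρ * (binomPoisson ρ (Real.exp (-t)) (i + 1) n - binomPoisson ρ (Real.exp (-t)) i n) +
        i * (binomPoisson ρ (Real.exp (-t)) (i - 1) n - binomPoisson ρ (Real.exp (-t)) i n)) t := by
  have h1 : HasDerivAt (fun t : ℝ => Real.exp (-t)) (-Real.exp (-t)) t := by
    simpa using (hasDerivAt_neg t).exp
  refine ((hasDerivAt_binomPoisson ρ i n (Real.exp (-t))).comp t h1).congr_deriv ?_
  rcases i with _ | i
  · simp only [binomPoisson_succ, Nat.cast_zero]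
    ring
  · simp only [binomPoisson_succ, Nat.add_sub_cancel]
    ring

/-- The transition function of the `M/M/∞` queue is unique. -/
lemma IsBirthDeathTransition.eq_binomPoisson {ρ : ℝ} (hρ : 0 < ρ) {P : ℝ≥0 → ℕ → ℕ → ℝ}
    (hP : IsBirthDeathTransition (fun _ => ρ) (fun n => (n : ℝ)) P) (i j : ℕ) {t : ℝ}
    (ht : 0 ≤ t) : P t.toNNReal i j = binomPoisson ρ (Real.exp (-t)) i j := by
  have hbp : ∀ k s, 0 ≤ s → 0 ≤ binomPoisson ρ (Real.exp (-s)) k j ∧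
      binomPoisson ρ (Real.exp (-s)) k j ≤ 1 := fun k s hs =>
    ⟨binomPoisson_nonneg hρ.le (Real.exp_pos _).le (Real.exp_le_one_iff.2 (by linarith)) k j,
      binomPoisson_le_one hρ.le (Real.exp_pos _).le (Real.exp_le_one_iff.2 (by linarith)) k j⟩
  have hc1 := fun k => hP.continuous k j
  have hc2 : ∀ k, Continuous fun s => binomPoisson ρ (Real.exp (-s)) k j := fun k =>
    (continuous_binomPoisson ρ k j).comp (by fun_prop)
  have hd1 := fun k s (hs : 0 < s) => hP.hasDerivAt (by simp) k j hs
  have hd2 := fun k s => hasDerivAt_binomPoisson_exp ρ k j s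
  have h0 : ∀ k, P (0 : ℝ).toNNReal k j = binomPoisson ρ (Real.exp (-0)) k j := fun k => by
    simp [hP.zero, binomPoisson_one]
  refine le_antisymm (sub_nonpos.1 ?_) (sub_nonpos.1 ?_)
  · refine nonpos_of_backward (B := 1) hρ
      (w := fun k s => P s.toNNReal k j - binomPoisson ρ (Real.exp (-s)) k j)
      (fun k => (hc1 k).sub (hc2 k))
      (fun k s hs => ((hd1 k s hs).sub (hd2 k s)).congr_deriv (by ring))
      (fun k s hs => by linarith [hP.le_one s.toNNReal k j, (hbp k s hs).1])
      (fun k => by linarith [h0 k]) i ht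
  · refine nonpos_of_backward (B := 1) hρ
      (w := fun k s => binomPoisson ρ (Real.exp (-s)) k j - P s.toNNReal k j)
      (fun k => (hc2 k).sub (hc1 k))
      (fun k s hs => ((hd2 k s).sub (hd1 k s hs)).congr_deriv (by ring))
      (fun k s hs => by linarith [hP.nonneg s.toNNReal k j, (hbp k s hs).2])
      (fun k => by linarith [h0 k]) i ht

lemma deathRate_one (m n : ℕ) : deathRate m 1 n = n := by
  simp [deathRate]

lemma p_eq_binomPoisson {Ω : Type*} [MeasurableSpace Ω] {μ : Measure Ω}
    [IsProbabilityMeasure μ] {m : ℕ} {ρ : ℝ} (hρ : 0 < ρ) {N : ℝ≥0 → Ω → ℕ}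
    (hN : IsErlangA μ m 1 ρ N) {n₀ : ℕ} (hn₀ : μ {ω | N 0 ω = n₀} ≠ 0) (n : ℕ) {t : ℝ}
    (ht : 0 ≤ t) : p μ N n₀ n t = binomPoisson ρ (Real.exp (-t)) n₀ n := by
  obtain ⟨hm, P, hP, hM⟩ := hN
  rw [show deathRate m 1 = fun n : ℕ => (n : ℝ) from funext (deathRate_one m)] at hP
  rw [← hP.eq_binomPoisson hρ n₀ n ht, p, measureReal_def, ProbabilityTheory.cond_apply
    (s := {ω | N 0 ω = n₀}) (hm 0 (measurableSet_singleton n₀)), ENNReal.toReal_mul, ENNReal.toReal_inv,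
    ← measureReal_def, ← measureReal_def]
  -- The Markov property with no earlier observations and `s = 0`.
  have h := hM 0 Fin.elim0 Fin.elim0 0 t.toNNReal n₀ n (fun l => l.elim0)
  simp only [IsEmpty.forall_iff, true_and, zero_add] at h
  rw [show {ω | N 0 ω = n₀} ∩ {ω | N t.toNNReal ω = n} =
    {ω | N 0 ω = n₀ ∧ N t.toNNReal ω = n} from rfl, h, ← mul_assoc, inv_mul_cancel₀, one_mul]
  exact ENNReal.toReal_ne_zero.2 ⟨hn₀, measure_ne_top _ _⟩

/-! ### The spectral representation -/

/-- The `n`-th Taylor coefficient of `(1 - z) ^ k * exp (ρ z)`, a Charlier polynomial. -/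
def charlier (ρ : ℝ) : ℕ → ℕ → ℝ :=
  binomShift 1 (-1) fun n => ρ ^ n / n.factorial

lemma charlier_zero_left (ρ : ℝ) (n : ℕ) : charlier ρ 0 n = ρ ^ n / n.factorial := rfl

lemma charlier_succ (ρ : ℝ) (k n : ℕ) :
    charlier ρ (k + 1) n = charlier ρ k n - prev (charlier ρ k) n := by
  have : charlier ρ (k + 1) n = 1 * charlier ρ k n + -1 * prev (charlier ρ k) n := rfl
  rw [this]
  ring

lemma charlier_zero_right (ρ : ℝ) (k : ℕ) : charlier ρ k 0 = 1 := by
  induction k with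
  | zero => simp [charlier_zero_left]
  | succ k ih => simp [charlier_succ, ih]

/-- Coefficient form of d/dz[(1 - z)^k e^{ρz}] = ρ(1 - z)^k e^{ρz} - k(1 - z)^{k-1}e^{ρz}. -/
lemma succ_mul_charlier (ρ : ℝ) (k n : ℕ) :
    (n + 1) * charlier ρ k (n + 1) = ρ * charlier ρ k n - k * charlier ρ (k - 1) n := by
  induction k generalizing n with
  | zero =>
    simp only [charlier_zero_left, Nat.factorial_succ]
    push_cast
    field_simp
    simp [pow_succ']
  | succ k ih =>
    have h1 := ih n
    have h3 : (k : ℝ) * charlier ρ k n =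
        k * (charlier ρ (k - 1) n - prev (charlier ρ (k - 1)) n) := by
      rcases k with _ | k
      · simp
      · rw [charlier_succ, Nat.add_sub_cancel]
    simp only [charlier_succ, prev_succ, Nat.add_sub_cancel]
    push_cast
    rcases n with _ | n
    · simp only [charlier_zero_right, prev_zero] at h1 h3 ⊢
      push_cast at *
      linear_combination h1 + h3
    · have h2 := ih n
      simp only [prev_succ] at h3 ⊢
      push_cast at *
      linear_combination h1 - h2 + h3

lemma hasSum_pow_div_factorial_mul_pred {c S : ℝ} {a : ℕ → ℝ}
    (h : HasSum (fun k : ℕ => c ^ k / k.factorial * a k) S) :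
    HasSum (fun k : ℕ => c ^ k / k.factorial * (k * a (k - 1))) (c * S) := by
  rw [← hasSum_nat_add_iff' 1]
  simp only [Finset.range_one, Finset.sum_singleton, Nat.cast_zero, zero_mul, mul_zero, sub_zero]
  refine (h.mul_left c).congr_fun fun k => ?_
  rw [Nat.add_sub_cancel, Nat.factorial_succ]
  push_cast
  field_simp
  ring

/-- Induction on `i`, with an inner induction on `n` for `i = 0` that starts from the exponential
series. `succ_mul_charlier` raises the index, and its term weighted by `k` becomes ρq times a known
sum after shifting `k`. Convergence is carried along by the induction. -/
lemma hasSum_charlier (ρ q : ℝ) (i n : ℕ) :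
    HasSum (fun k : ℕ => (ρ * q) ^ k / k.factorial * (charlier ρ k i * charlier ρ k n))
      (ρ ^ i / i.factorial * Real.exp ρ * binomPoisson ρ q i n) := by
  induction i generalizing n with
  | zero =>
    simp only [charlier_zero_right, one_mul, pow_zero, Nat.factorial_zero, Nat.cast_one, div_one]
    induction n with
    | zero =>
      simp only [charlier_zero_right, mul_one, binomPoisson_zero_left, pow_zero,
        Nat.factorial_zero, Nat.cast_one, div_one]
      rw [← Real.exp_add, show ρ + -(ρ * (1 - q)) = ρ * q by ring, Real.exp_eq_exp_ℝ]
      exact NormedSpace.expSeries_div_hasSum_exp (ρ * q)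
    | succ n ih =>
      have h := ((ih.mul_left ρ).sub (hasSum_pow_div_factorial_mul_pred ih)).div_const
        ((n : ℝ) + 1)
      have hn : (n : ℝ) + 1 ≠ 0 := by positivity
      have e : Real.exp ρ * binomPoisson ρ q 0 (n + 1) =
          (ρ * (Real.exp ρ * binomPoisson ρ q 0 n) -
            ρ * q * (Real.exp ρ * binomPoisson ρ q 0 n)) / (n + 1) := by
        simp only [binomPoisson_zero_left, Nat.factorial_succ]
        push_cast
        field_simp
        ring
      rw [e]
      refine h.congr_fun fun k => ?_
      rw [eq_div_iff hn]
      linear_combination (ρ * q) ^ k / k.factorial * succ_mul_charlier ρ k n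
  | succ i ih =>
    have hp : HasSum (fun k : ℕ => (ρ * q) ^ k / k.factorial *
        (charlier ρ k i * prev (charlier ρ k) n))
        (ρ ^ i / i.factorial * Real.exp ρ * prev (binomPoisson ρ q i) n) := by
      rcases n with _ | n
      · simp
      · exact ih n
    -- The factor `charlier ρ k n` is rewritten by `charlier_succ` at level `k - 1`, so that both
    -- factors shift together.
    have h2 := hasSum_pow_div_factorial_mul_pred (c := ρ * q)
      (a := fun k => charlier ρ k i * (charlier ρ k n - prev (charlier ρ k) n))
      (((ih n).sub hp).congr_fun fun k => by ring)
    have h := (((ih n).mul_left ρ).sub h2).div_const ((i : ℝ) + 1)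
    have hn : (i : ℝ) + 1 ≠ 0 := by positivity
    have e : ρ ^ (i + 1) / (i + 1).factorial * Real.exp ρ * binomPoisson ρ q (i + 1) n =
        (ρ * (ρ ^ i / i.factorial * Real.exp ρ * binomPoisson ρ q i n) -
          ρ * q * (ρ ^ i / i.factorial * Real.exp ρ * binomPoisson ρ q i n -
            ρ ^ i / i.factorial * Real.exp ρ * prev (binomPoisson ρ q i) n)) / (i + 1) := by
      simp only [binomPoisson_succ, Nat.factorial_succ]
      push_cast
      field_simp
      ring
    rw [e]
    refine h.congr_fun fun k => ?_
    have h3 : (k : ℝ) * charlier ρ k n =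
        k * (charlier ρ (k - 1) n - prev (charlier ρ (k - 1)) n) := by
      rcases k with _ | k
      · simp
      · rw [charlier_succ, Nat.add_sub_cancel]
    rw [eq_div_iff hn]
    linear_combination (ρ * q) ^ k / k.factorial * charlier ρ k n * succ_mul_charlier ρ k i -
      (ρ * q) ^ k / k.factorial * charlier ρ (k - 1) i * h3

/-- Detailed balance for the `M/M/∞` queue. -/
lemma binomPoisson_symm (ρ q : ℝ) (i n : ℕ) :
    ρ ^ i / i.factorial * binomPoisson ρ q i n = ρ ^ n / n.factorial * binomPoisson ρ q n i := by
  have h := (hasSum_charlier ρ q i n).unique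
    ((hasSum_charlier ρ q n i).congr_fun fun k => by ring)
  have := Real.exp_pos ρ
  refine mul_right_cancel₀ this.ne' ?_
  linear_combination h

lemma charlier_eq_sum (ρ : ℝ) (k n : ℕ) :
    charlier ρ k n = ∑ j ∈ Finset.range (min k n + 1),
      (k.choose j : ℝ) * (-1) ^ j * (ρ ^ (n - j) / (n - j).factorial) := by
  rw [charlier, binomShift_eq_sum, min_comm]
  simp

lemma binomPoisson_exp_eq_sum {ρ : ℝ} (hρ : 0 < ρ) (n n₀ : ℕ) (t : ℝ) :
    binomPoisson ρ (Real.exp (-t)) n₀ n =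
      ρ ^ n * Real.exp (-ρ * (1 - Real.exp (-t))) *
        ∑ j ∈ Finset.range (min n n₀ + 1),
          (n₀.choose j : ℝ) * (ρ ^ j)⁻¹ * Real.exp (-(j * t)) *
            (1 - Real.exp (-t)) ^ (n + n₀ - 2 * j) * (1 / ((n - j).factorial : ℝ)) := by
  rw [binomPoisson, binomShift_eq_sum, Finset.mul_sum]
  refine Finset.sum_congr rfl fun j hj => ?_
  have hj' : j ≤ n ∧ j ≤ n₀ := by
    rw [Finset.mem_range, Nat.lt_succ_iff, le_min_iff] at hj
    exact hj
  rw [show n + n₀ - 2 * j = (n₀ - j) + (n - j) by omega, pow_add, mul_pow,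
    pow_sub₀ ρ hρ.ne' hj'.1, neg_mul, ← mul_neg (j : ℝ) t, Real.exp_nat_mul]
  ring

lemma tendsto_binomPoisson_exp (ρ : ℝ) (n₀ n : ℕ) : Tendsto (fun t => binomPoisson ρ (Real.exp (-t)) n₀ n) atTop
    (𝓝 (Real.exp (-ρ) * ρ ^ n / n.factorial)) := by
  rw [← binomPoisson_zero_middle ρ n₀ n]
  exact ((continuous_binomPoisson ρ n₀ n).tendsto 0).comp Real.tendsto_exp_neg_atTop_nhds_zero

/-! ### The functions `F_n` -/

/-- The integrand of `F`, with exponent `m` in place of `n + 1`. -/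
def kernelF (ρ : ℝ) (θ : ℂ) (m : ℕ) (z : ℂ) : ℂ :=
  Complex.exp (ρ * z) / (z ^ m * (1 - z) ^ θ)

lemma F_eq (ρ r : ℝ) (n : ℕ) (θ : ℂ) :
    F ρ r n θ = (2 * Real.pi * Complex.I)⁻¹ * ∮ z in C(0, r), kernelF ρ θ (n + 1) z := rfl

lemma cpow_ne_zero_of_ne_zero {z : ℂ} (hz : z ≠ 0) (θ : ℂ) : z ^ θ ≠ 0 := by
  simp [Complex.cpow_eq_zero_iff, hz]

/-- For r < 1 the point 1 - z stays in the right half-plane, so the principal power is analytic on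
the whole closed disc. -/
lemma one_sub_mem_slitPlane {r : ℝ} (hr₁ : r < 1) {z : ℂ} (hz : z ∈ Metric.closedBall (0 : ℂ) r) :
    1 - z ∈ Complex.slitPlane := by
  left
  have h := (Complex.abs_re_le_norm z).trans (mem_closedBall_zero_iff.1 hz)
  have := (abs_le.1 h).2
  simp only [Complex.sub_re, Complex.one_re]
  linarith

lemma differentiableAt_one_sub_cpow {r : ℝ} (hr₁ : r < 1) (θ : ℂ) {z : ℂ}
    (hz : z ∈ Metric.closedBall (0 : ℂ) r) : DifferentiableAt ℂ (fun z => (1 - z) ^ θ) z :=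
  (((hasDerivAt_id z).const_sub 1).cpow_const
    (one_sub_mem_slitPlane hr₁ hz)).differentiableAt

lemma differentiableAt_kernelF_zero (ρ : ℝ) (θ : ℂ) {r : ℝ} (hr₁ : r < 1) {z : ℂ}
    (hz : z ∈ Metric.closedBall (0 : ℂ) r) :
    DifferentiableAt ℂ (kernelF ρ θ 0) z := by
  have h1 := differentiableAt_one_sub_cpow hr₁ θ hz
  have h2 := cpow_ne_zero_of_ne_zero
    (Complex.slitPlane_ne_zero (one_sub_mem_slitPlane hr₁ hz)) θ
  unfold kernelF
  simp only [pow_zero, one_mul]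
  fun_prop (disch := assumption)

lemma circleIntegrable_kernelF (ρ : ℝ) (θ : ℂ) (m : ℕ) {r : ℝ} (hr₀ : 0 < r) (hr₁ : r < 1) :
    CircleIntegrable (kernelF ρ θ m) 0 r := by
  refine ContinuousOn.circleIntegrable hr₀.le fun z hz => ContinuousAt.continuousWithinAt ?_
  have hz0 : z ^ m ≠ 0 := pow_ne_zero _ (ne_zero_of_mem_sphere hr₀.ne' ⟨z, hz⟩)
  have h1 := (differentiableAt_kernelF_zero ρ θ hr₁ (Metric.sphere_subset_closedBall hz))
  have h2 : kernelF ρ θ m = fun z => (z ^ m)⁻¹ * kernelF ρ θ 0 z := by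
    ext w
    simp only [kernelF, pow_zero, one_mul, div_eq_mul_inv, mul_inv]
    ring
  rw [h2]
  exact (((continuous_pow m).continuousAt).inv₀ hz0).mul h1.continuousAt

/-- Exponent 0 corresponds to index -1: the pole is gone, and F_{-1} = 0 by Cauchy's theorem. -/
lemma circleIntegral_kernelF_zero (ρ : ℝ) (θ : ℂ) {r : ℝ} (hr₀ : 0 < r) (hr₁ : r < 1) :
    ∮ z in C(0, r), kernelF ρ θ 0 z = 0 :=
  Complex.circleIntegral_eq_zero_of_differentiable_on_off_countable hr₀.le countable_empty
    (fun _ hz => (differentiableAt_kernelF_zero ρ θ hr₁ hz).continuousAt.continuousWithinAt)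
    fun _ hz => differentiableAt_kernelF_zero ρ θ hr₁ (Metric.ball_subset_closedBall hz.1)

lemma prev_F (ρ : ℝ) (θ : ℂ) (n : ℕ) {r : ℝ} (hr₀ : 0 < r) (hr₁ : r < 1) :
    (2 * Real.pi * Complex.I)⁻¹ * ∮ z in C(0, r), kernelF ρ θ n z =
      prev (fun n => F ρ r n θ) n := by
  rcases n with _ | n
  · rw [circleIntegral_kernelF_zero ρ θ hr₀ hr₁, mul_zero, prev_zero]
  · rfl

lemma F_zero (ρ : ℝ) (θ : ℂ) {r : ℝ} (hr₀ : 0 < r) (hr₁ : r < 1) : F ρ r 0 θ = 1 := by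
  have h := DifferentiableOn.circleIntegral_sub_inv_smul (c := 0) (R := r) (w := 0)
    (f := kernelF ρ θ 0)
    (fun z hz => (differentiableAt_kernelF_zero ρ θ hr₁ hz).differentiableWithinAt)
    (Metric.mem_ball_self hr₀)
  have h2 : kernelF ρ θ 0 0 = 1 := by simp [kernelF]
  have h3 : ∀ z, (z - 0)⁻¹ • kernelF ρ θ 0 z = kernelF ρ θ (0 + 1) z := by
    intro z
    simp only [kernelF, pow_zero, one_mul, div_eq_mul_inv, mul_inv, zero_add, pow_one, sub_zero,
      smul_eq_mul]
    ring
  simp only [h3, h2, smul_eq_mul, mul_one] at h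
  rw [F_eq, h]
  exact inv_mul_cancel₀ Complex.two_pi_I_ne_zero

/-- The extra factor 1 - z in the primitive makes its derivative a combination of three consecutive
kernels. Its integral over the closed circle vanishes, which is the recurrence for F. -/
lemma hasDerivAt_primitive_kernelF (ρ : ℝ) (θ : ℂ) (n : ℕ) {r : ℝ} (hr₀ : 0 < r) (hr₁ : r < 1)
    {z : ℂ} (hz : z ∈ Metric.sphere (0 : ℂ) r) :
    HasDerivAt (fun z : ℂ => Complex.exp (ρ * z) * (z ^ (n + 1))⁻¹ * (1 - z) ^ (1 - θ))
      ((θ + ρ + n) * kernelF ρ θ (n + 1) z - ρ * kernelF ρ θ n z -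
        (n + 1) * kernelF ρ θ (n + 2) z) z := by
  have hz0 : z ≠ 0 := ne_zero_of_mem_sphere hr₀.ne' ⟨z, hz⟩
  have hs := one_sub_mem_slitPlane hr₁ (Metric.sphere_subset_closedBall hz)
  have hs0 := Complex.slitPlane_ne_zero hs
  have h1 : HasDerivAt (fun z : ℂ => Complex.exp (ρ * z)) (Complex.exp (ρ * z) * ρ) z := by
    simpa using ((hasDerivAt_id z).const_mul (ρ : ℂ)).cexp
  have h2 := (hasDerivAt_pow (n + 1) z).fun_inv (pow_ne_zero _ hz0)
  have h3 := ((hasDerivAt_id z).const_sub 1).cpow_const (c := 1 - θ) hs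
  refine ((h1.mul h2).mul h3).congr_deriv ?_
  simp only [id, Pi.mul_apply, Nat.add_sub_cancel, kernelF, sub_sub_cancel_left]
  rw [Complex.cpow_sub _ _ hs0, Complex.cpow_neg, Complex.cpow_one]
  have hc := cpow_ne_zero_of_ne_zero hs0 θ
  push_cast
  field_simp
  ring

lemma succ_mul_F_succ (ρ : ℝ) (θ : ℂ) (n : ℕ) {r : ℝ} (hr₀ : 0 < r) (hr₁ : r < 1) :
    (n + 1) * F ρ r (n + 1) θ =
      (θ + ρ + n) * F ρ r n θ - ρ * prev (fun n => F ρ r n θ) n := by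
  have h := circleIntegral.integral_eq_zero_of_hasDerivWithinAt hr₀.le fun z hz =>
    (hasDerivAt_primitive_kernelF ρ θ n hr₀ hr₁ hz).hasDerivWithinAt
  have hi : ∀ (a : ℂ) m, CircleIntegrable (fun z => a * kernelF ρ θ m z) 0 r := fun a m =>
    (circleIntegrable_kernelF ρ θ m hr₀ hr₁).const_fun_smul (a := a)
  have hi2 : CircleIntegrable
      (fun z => (θ + ρ + n) * kernelF ρ θ (n + 1) z - ρ * kernelF ρ θ n z) 0 r :=
    (hi _ _).sub (hi _ _)
  rw [circleIntegral.integral_sub hi2 (hi _ _),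
    circleIntegral.integral_sub (hi _ _) (hi _ _), circleIntegral.integral_const_mul,
    circleIntegral.integral_const_mul, circleIntegral.integral_const_mul] at h
  rw [← prev_F ρ θ n hr₀ hr₁, F_eq, F_eq]
  linear_combination -(2 * Real.pi * Complex.I)⁻¹ * h

lemma kernelF_neg_natCast (ρ : ℝ) (k m : ℕ) (z : ℂ) :
    kernelF ρ (-k) m z = (1 - z) ^ k / z ^ m * Complex.exp (ρ * z) := by
  rw [kernelF, Complex.cpow_neg, Complex.cpow_natCast, div_eq_mul_inv, mul_inv, inv_inv]
  ring

lemma F_neg_natCast_succ (ρ : ℝ) (k n : ℕ) {r : ℝ} (hr₀ : 0 < r) (hr₁ : r < 1) :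
    F ρ r n (-(k + 1 : ℕ)) = F ρ r n (-k) - prev (fun n => F ρ r n (-k)) n := by
  rw [← prev_F ρ (-k) n hr₀ hr₁, F_eq, F_eq, ← mul_sub, ← circleIntegral.integral_sub
    (circleIntegrable_kernelF _ _ _ hr₀ hr₁) (circleIntegrable_kernelF _ _ _ hr₀ hr₁)]
  congr 1
  refine circleIntegral.integral_congr hr₀.le fun z hz => ?_
  have hz0 : z ≠ 0 := ne_zero_of_mem_sphere hr₀.ne' ⟨z, hz⟩
  simp only [kernelF_neg_natCast]
  field_simp
  ring

/-- For θ = 0 the recurrence yields the exponential coefficients; lowering θ by 1 multiplies the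
integrand by 1 - z, as in `charlier_succ`. -/
lemma F_neg_natCast (ρ : ℝ) (k n : ℕ) {r : ℝ} (hr₀ : 0 < r) (hr₁ : r < 1) :
    F ρ r n (-k) = (charlier ρ k n : ℂ) := by
  induction k generalizing n with
  | zero =>
    simp only [Nat.cast_zero, neg_zero, charlier_zero_left]
    induction n using Nat.strong_induction_on with
    | _ n ih =>
      rcases n with _ | n
      · simp [F_zero ρ 0 hr₀ hr₁]
      · have h := succ_mul_F_succ ρ 0 n hr₀ hr₁
        have hn : (n : ℂ) + 1 ≠ 0 := by exact_mod_cast n.succ_ne_zero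
        refine mul_left_cancel₀ hn ?_
        rw [h, ih n n.lt_succ_self]
        rcases n with _ | n
        · simp
        · rw [prev_succ, ih n (by omega)]
          simp only [Nat.factorial_succ]
          push_cast at hn ⊢
          have hn' : (n : ℂ) + 1 ≠ 0 := by exact_mod_cast n.succ_ne_zero
          have hf : (n.factorial : ℂ) ≠ 0 := by exact_mod_cast n.factorial_ne_zero
          field_simp
          ring
  | succ k ih =>
    rw [F_neg_natCast_succ ρ k n hr₀ hr₁, charlier_succ, ih]
    rcases n with _ | n
    · simp
    · simp [ih]

/-! ### The Laplace transform of the transition function -/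

/-- The Laplace transform of the transition function of the `M/M/∞` queue. -/
def resolvent (ρ : ℝ) (θ : ℂ) (i n : ℕ) : ℂ :=
  ∫ t : ℝ in Ioi 0, Complex.exp (-θ * t) * (binomPoisson ρ (Real.exp (-t)) i n : ℂ)

lemma norm_exp_neg_mul_ofReal (θ : ℂ) (t : ℝ) :
    ‖Complex.exp (-θ * t)‖ = Real.exp (-θ.re * t) := by
  simp [Complex.norm_exp]

lemma norm_binomPoisson_exp_le {ρ : ℝ} (hρ : 0 < ρ) (i n : ℕ) {t : ℝ} (ht : 0 ≤ t) :
    ‖(binomPoisson ρ (Real.exp (-t)) i n : ℂ)‖ ≤ 1 := by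
  have h1 : Real.exp (-t) ≤ 1 := Real.exp_le_one_iff.2 (by linarith)
  rw [Complex.norm_real, Real.norm_of_nonneg (binomPoisson_nonneg hρ.le (Real.exp_pos _).le h1 i n)]
  exact binomPoisson_le_one hρ.le (Real.exp_pos _).le h1 i n

lemma norm_exp_mul_binomPoisson_le {ρ : ℝ} (hρ : 0 < ρ) (θ : ℂ) (i n : ℕ) {t : ℝ} (ht : 0 ≤ t) :
    ‖Complex.exp (-θ * t) * (binomPoisson ρ (Real.exp (-t)) i n : ℂ)‖ ≤
      Real.exp (-θ.re * t) := by
  rw [norm_mul, norm_exp_neg_mul_ofReal]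
  exact mul_le_of_le_one_right (Real.exp_pos _).le (norm_binomPoisson_exp_le hρ i n ht)

lemma integrableOn_resolvent {ρ : ℝ} (hρ : 0 < ρ) {θ : ℂ} (hθ : 0 < θ.re) (i n : ℕ) :
    IntegrableOn (fun t : ℝ => Complex.exp (-θ * t) * (binomPoisson ρ (Real.exp (-t)) i n : ℂ))
      (Ioi 0) := by
  refine (integrableOn_exp_mul_Ioi (neg_lt_zero.2 hθ) 0).mono' ?_ ?_
  · have := continuous_binomPoisson ρ i n
    exact Continuous.aestronglyMeasurable (by fun_prop)
  · refine (ae_restrict_iff' measurableSet_Ioi).2 (Eventually.of_forall fun t ht => ?_)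
    exact norm_exp_mul_binomPoisson_le hρ θ i n (le_of_lt ht)

/-- The derivative of e^{-θt} times the transition probability is integrated over (0, ∞); the right
side is the boundary term at t = 0. -/
lemma resolvent_equation {ρ : ℝ} (hρ : 0 < ρ) {θ : ℂ} (hθ : 0 < θ.re) (i n : ℕ) :
    ρ * (resolvent ρ θ (i + 1) n - resolvent ρ θ i n) +
      i * (resolvent ρ θ (i - 1) n - resolvent ρ θ i n) - θ * resolvent ρ θ i n =
      -(if i = n then 1 else 0) := by
  have hi := fun k => integrableOn_resolvent hρ hθ k n
  have hd : ∀ t : ℝ, HasDerivAt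
      (fun t : ℝ => Complex.exp (-θ * t) * (binomPoisson ρ (Real.exp (-t)) i n : ℂ))
      (ρ * (Complex.exp (-θ * t) * (binomPoisson ρ (Real.exp (-t)) (i + 1) n : ℂ) -
        Complex.exp (-θ * t) * (binomPoisson ρ (Real.exp (-t)) i n : ℂ)) +
      i * (Complex.exp (-θ * t) * (binomPoisson ρ (Real.exp (-t)) (i - 1) n : ℂ) -
        Complex.exp (-θ * t) * (binomPoisson ρ (Real.exp (-t)) i n : ℂ)) -
      θ * (Complex.exp (-θ * t) * (binomPoisson ρ (Real.exp (-t)) i n : ℂ))) t := by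
    intro t
    have h1 : HasDerivAt (fun t : ℝ => Complex.exp (-θ * t)) (Complex.exp (-θ * t) * -θ) t := by
      simpa using ((hasDerivAt_id (t : ℂ)).const_mul (-θ)).cexp.comp_ofReal
    refine (h1.mul (hasDerivAt_binomPoisson_exp ρ i n t).ofReal_comp).congr_deriv ?_
    push_cast
    ring
  have hlim : Tendsto
      (fun t : ℝ => Complex.exp (-θ * t) * (binomPoisson ρ (Real.exp (-t)) i n : ℂ)) atTop
      (𝓝 0) := by
    refine squeeze_zero_norm' (a := fun t => Real.exp (-θ.re * t)) ?_ ?_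
    · filter_upwards [eventually_ge_atTop 0] with t ht
      exact norm_exp_mul_binomPoisson_le hρ θ i n ht
    · exact Real.tendsto_exp_atBot.comp
        (tendsto_id.const_mul_atTop_of_neg (neg_lt_zero.2 hθ))
  have hs : ∀ (a : ℂ) (k l : ℕ), IntegrableOn (fun t : ℝ =>
      a * (Complex.exp (-θ * t) * (binomPoisson ρ (Real.exp (-t)) k n : ℂ) -
        Complex.exp (-θ * t) * (binomPoisson ρ (Real.exp (-t)) l n : ℂ))) (Ioi 0) :=
    fun a k l => ((hi k).sub (hi l)).const_mul a
  have hs2 : IntegrableOn (fun t : ℝ =>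
      ρ * (Complex.exp (-θ * t) * (binomPoisson ρ (Real.exp (-t)) (i + 1) n : ℂ) -
        Complex.exp (-θ * t) * (binomPoisson ρ (Real.exp (-t)) i n : ℂ)) +
      i * (Complex.exp (-θ * t) * (binomPoisson ρ (Real.exp (-t)) (i - 1) n : ℂ) -
        Complex.exp (-θ * t) * (binomPoisson ρ (Real.exp (-t)) i n : ℂ))) (Ioi 0) :=
    (hs ρ (i + 1) i).add (hs i (i - 1) i)
  have h := integral_Ioi_of_hasDerivAt_of_tendsto' (fun t _ => hd t)
    (hs2.sub ((hi i).const_mul θ)) hlim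
  rw [integral_sub hs2 ((hi i).const_mul θ), integral_add (hs _ _ _) (hs _ _ _),
    integral_const_mul, integral_const_mul, integral_const_mul, integral_sub (hi _) (hi _),
    integral_sub (hi _) (hi _)] at h
  simp only [resolvent]
  rw [h]
  split_ifs with hin <;> simp [binomPoisson_one, hin]

lemma resolvent_symm (ρ : ℝ) (θ : ℂ) (i n : ℕ) :
    (ρ : ℂ) ^ i / i.factorial * resolvent ρ θ i n =
      (ρ : ℂ) ^ n / n.factorial * resolvent ρ θ n i := by
  rw [resolvent, resolvent, ← integral_const_mul, ← integral_const_mul]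
  congr 1
  ext t
  have h := congrArg (fun x : ℝ => (x : ℂ)) (binomPoisson_symm ρ (Real.exp (-t)) i n)
  push_cast at h ⊢
  linear_combination Complex.exp (-θ * t) * h

/-- For initial states below `n` the resolvent equation has no source, and at 0 it has no downward
term. So its value at 0 fixes the solution up to `n`, and i!/ρ^i · F_i obeys the same recurrence
with value 1 at 0. -/
lemma resolvent_eq_of_le {ρ : ℝ} (hρ : 0 < ρ) {θ : ℂ} (hθ : 0 < θ.re) {r : ℝ} (hr₀ : 0 < r)
    (hr₁ : r < 1) {i n : ℕ} (hin : i ≤ n) :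
    resolvent ρ θ i n = resolvent ρ θ 0 n * (i.factorial / (ρ : ℂ) ^ i) * F ρ r i θ := by
  have hρ' : (ρ : ℂ) ≠ 0 := by exact_mod_cast hρ.ne'
  induction i using Nat.strong_induction_on with
  | _ i ih =>
    rcases i with _ | i
    · simp [F_zero ρ θ hr₀ hr₁]
    · have h := resolvent_equation hρ hθ i n
      rw [if_neg (by omega), ih i (by omega) (by omega)] at h
      have hF := succ_mul_F_succ ρ θ i hr₀ hr₁
      have hf : (i.factorial : ℂ) ≠ 0 := by exact_mod_cast i.factorial_ne_zero
      refine mul_left_cancel₀ hρ' ?_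
      rw [Nat.factorial_succ, pow_succ]
      push_cast
      have e : (ρ : ℂ) * (resolvent ρ θ 0 n * (((i : ℂ) + 1) * i.factorial / (ρ ^ i * ρ)) *
          F ρ r (i + 1) θ) = resolvent ρ θ 0 n * (i.factorial / ρ ^ i) *
          ((i + 1) * F ρ r (i + 1) θ) := by
        field_simp
      rw [e, hF]
      rcases i with _ | i
      · simp only [prev_zero]
        push_cast at h ⊢
        linear_combination h
      · rw [Nat.add_sub_cancel, ih i (by omega) (by omega)] at h
        simp only [prev_succ, Nat.factorial_succ, pow_succ] at h ⊢
        push_cast at h ⊢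
        have e2 : (i.factorial : ℂ) / ρ ^ i = ρ * (i.factorial / (ρ ^ i * ρ)) := by
          field_simp
        rw [e2] at h
        linear_combination h

/-! ### Two Laplace integrals -/

lemma integrableOn_cpow_mul_exp_neg_mul {a z : ℂ} (ha : 0 < a.re) (hz : 0 < z.re) :
    IntegrableOn (fun t : ℝ => (t : ℂ) ^ (a - 1) * Complex.exp (-(z * t))) (Ioi 0) := by
  have h : IntegrableOn (fun t : ℝ => t ^ (a.re - 1) * Real.exp (-z.re * t)) (Ioi 0) :=
    integrableOn_rpow_mul_exp_neg_mul_rpow (p := 1) (s := a.re - 1) (by linarith) one_pos hz |>.congr_fun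
      (fun t _ => by simp) measurableSet_Ioi
  refine h.mono' ?_ ?_
  · refine ContinuousOn.aestronglyMeasurable (fun t ht => ContinuousAt.continuousWithinAt ?_)
      measurableSet_Ioi
    exact (Complex.continuousAt_ofReal_cpow_const _ _ (Or.inr (ne_of_gt ht))).mul
      (by fun_prop)
  · refine (ae_restrict_iff' measurableSet_Ioi).2 (Eventually.of_forall fun t ht => ?_)
    rw [norm_mul, Complex.norm_cpow_eq_rpow_re_of_pos ht, Complex.norm_exp]
    simp

lemma differentiableAt_integral_cpow_mul_exp {a z : ℂ} (ha : 0 < a.re) (hz : 0 < z.re) :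
    DifferentiableAt ℂ
      (fun z : ℂ => ∫ t : ℝ in Ioi 0, (t : ℂ) ^ (a - 1) * Complex.exp (-(z * t))) z := by
  -- On the ball of this radius Re w ≥ Re z / 2, which gives one integrable dominating function.
  have hz2 : 0 < z.re / 2 := by positivity
  have hmeas : ∀ (b w : ℂ), AEStronglyMeasurable
      (fun t : ℝ => (t : ℂ) ^ b * Complex.exp (-(w * t))) (volume.restrict (Ioi 0)) := by
    intro b w
    refine ContinuousOn.aestronglyMeasurable (fun t ht => ContinuousAt.continuousWithinAt ?_)
      measurableSet_Ioi
    exact (Complex.continuousAt_ofReal_cpow_const _ _ (Or.inr (ne_of_gt ht))).mul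
      (by fun_prop)
  have hb : IntegrableOn (fun t : ℝ => t ^ a.re * Real.exp (-(z.re / 2) * t)) (Ioi 0) :=
    integrableOn_rpow_mul_exp_neg_mul_rpow (p := 1) (s := a.re) (by linarith) one_pos hz2 |>.congr_fun
      (fun t _ => by simp) measurableSet_Ioi
  refine (hasDerivAt_integral_of_dominated_loc_of_deriv_le
    (F' := fun w t => (t : ℂ) ^ (a - 1) * (Complex.exp (-(w * t)) * -(t : ℂ)))
    (Metric.ball_mem_nhds z hz2) (Eventually.of_forall fun w => hmeas _ w)
    (integrableOn_cpow_mul_exp_neg_mul ha hz) ?_ ?_ hb ?_).2.differentiableAt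
  · refine ((hmeas a z).neg).congr ?_
    refine (ae_restrict_iff' measurableSet_Ioi).2 (Eventually.of_forall fun t ht => ?_)
    have ht0 : (t : ℂ) ≠ 0 := by exact_mod_cast (ne_of_gt ht)
    simp only [Pi.neg_apply]
    rw [Complex.cpow_sub _ _ ht0, Complex.cpow_one]
    field_simp
  · refine (ae_restrict_iff' measurableSet_Ioi).2 (Eventually.of_forall fun t ht w hw => ?_)
    have ht' : 0 < t := ht
    have hre : z.re / 2 ≤ w.re := by
      have h1 := (Complex.abs_re_le_norm (w - z)).trans_lt (mem_ball_iff_norm.1 hw)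
      have h2 := (abs_lt.1 h1).1
      simp only [Complex.sub_re] at h2
      linarith
    rw [norm_mul, norm_mul, norm_neg, Complex.norm_cpow_eq_rpow_re_of_pos ht', Complex.norm_exp,
      Complex.norm_real, Real.norm_of_nonneg ht'.le, Complex.sub_re, Complex.one_re,
      Real.rpow_sub_one ht'.ne', show ∀ u v : ℝ, u / t * (v * t) = u * v by intros; field_simp]
    refine mul_le_mul_of_nonneg_left (Real.exp_le_exp.2 ?_) (Real.rpow_nonneg ht'.le _)
    simp only [Complex.neg_re, Complex.mul_re, Complex.ofReal_re, Complex.ofReal_im, mul_zero,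
      sub_zero]
    nlinarith
  · refine Eventually.of_forall fun t w _ => ?_
    have h1 : HasDerivAt (fun w : ℂ => Complex.exp (-(w * t))) (Complex.exp (-(w * t)) * -t) w := by
      simpa using ((hasDerivAt_id w).mul_const (t : ℂ)).neg.cexp
    exact h1.const_mul _

/-- Both sides are analytic in the right half-plane and agree on the positive reals by the Gamma
integral; the identity theorem at 1 does the rest. -/
lemma integral_cpow_mul_exp_neg_mul {a z : ℂ} (ha : 0 < a.re) (hz : 0 < z.re) :
    ∫ t : ℝ in Ioi 0, (t : ℂ) ^ (a - 1) * Complex.exp (-(z * t)) = Complex.Gamma a / z ^ a := by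
  have hU : IsOpen {z : ℂ | 0 < z.re} := isOpen_lt continuous_const Complex.continuous_re
  have hpre : IsPreconnected {z : ℂ | 0 < z.re} := (convex_halfSpace_re_gt 0).isPreconnected
  have hf : AnalyticOnNhd ℂ
      (fun z : ℂ => ∫ t : ℝ in Ioi 0, (t : ℂ) ^ (a - 1) * Complex.exp (-(z * t)))
      {z : ℂ | 0 < z.re} :=
    DifferentiableOn.analyticOnNhd (fun w hw =>
      (differentiableAt_integral_cpow_mul_exp ha hw).differentiableWithinAt) hU
  have hg : AnalyticOnNhd ℂ (fun z : ℂ => Complex.Gamma a / z ^ a) {z : ℂ | 0 < z.re} := by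
    refine DifferentiableOn.analyticOnNhd (fun w hw => ?_) hU
    have hw' : w ∈ Complex.slitPlane := Or.inl hw
    have h0 := cpow_ne_zero_of_ne_zero (Complex.slitPlane_ne_zero hw') a
    exact ((differentiableAt_const _).div
      ((hasDerivAt_id w).cpow_const hw').differentiableAt h0).differentiableWithinAt
  refine hf.eqOn_of_preconnected_of_frequently_eq hg hpre (z₀ := 1) (by simp) ?_ hz
  have hreal : ∀ r : ℝ, 0 < r → ∫ t : ℝ in Ioi 0, (t : ℂ) ^ (a - 1) * Complex.exp (-(r * t)) =
      Complex.Gamma a / (r : ℂ) ^ a := by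
    intro r hr
    rw [Complex.integral_cpow_mul_exp_neg_mul_Ioi ha hr, one_div, ← Complex.ofReal_inv,
      Complex.ofReal_inv, Complex.inv_cpow _ _ (by
        rw [Complex.arg_ofReal_of_nonneg hr.le]
        exact Real.pi_pos.ne)]
    rw [div_eq_mul_inv, mul_comm]
  have ht : Tendsto (fun x : ℝ => (x : ℂ)) (𝓝[≠] 1) (𝓝[≠] 1) := by
    refine tendsto_nhdsWithin_iff.2 ⟨?_, ?_⟩
    · exact (Complex.continuous_ofReal.tendsto' 1 1 (by simp)).mono_left nhdsWithin_le_nhds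
    · filter_upwards [self_mem_nhdsWithin] with x hx
      simpa using hx
  refine ht.frequently (Eventually.frequently ?_)
  filter_upwards [nhdsWithin_le_nhds (Ioi_mem_nhds zero_lt_one)] with x hx using hreal x hx

/-- The convolution of `t ^ (θ - 1) * exp t` and `t ^ n / n!`, in terms of the Laplace transform
of the transition function of the `M/M/∞` queue. -/
lemma integral_cpow_mul_pow_mul_exp {x : ℝ} (hx : 0 < x) (θ : ℂ) (n : ℕ) :
    ∫ y : ℝ in 0..x, (y : ℂ) ^ (θ - 1) * Complex.exp y * ((x - y : ℂ) ^ n / n.factorial) =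
      (x : ℂ) ^ θ * Complex.exp x * resolvent x θ 0 n := by
  -- Substitution y = xe^{-t}, with `x` in the role of the arrival rate.
  have himage : (fun t : ℝ => x * Real.exp (-t)) '' Ioi 0 = Ioo 0 x := by
    ext y
    simp only [mem_image, mem_Ioi, mem_Ioo]
    constructor
    · rintro ⟨t, ht, rfl⟩
      refine ⟨by positivity, ?_⟩
      have : Real.exp (-t) < 1 := Real.exp_lt_one_iff.2 (by linarith)
      nlinarith
    · rintro ⟨h0, h1⟩
      have hyx : 0 < y / x := div_pos h0 hx
      refine ⟨-Real.log (y / x), ?_, ?_⟩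
      · have : Real.log (y / x) < 0 := Real.log_neg hyx ((div_lt_one hx).2 h1)
        linarith
      · rw [neg_neg, Real.exp_log hyx]
        field_simp
  have hderiv : ∀ t ∈ Ioi (0 : ℝ), HasDerivWithinAt (fun t : ℝ => x * Real.exp (-t))
      (-(x * Real.exp (-t))) (Ioi 0) t := fun t _ => by
    simpa using ((hasDerivAt_neg t).exp.const_mul x).hasDerivWithinAt
  have hinj : InjOn (fun t : ℝ => x * Real.exp (-t)) (Ioi 0) := fun s _ t _ h => by
    have := mul_left_cancel₀ hx.ne' h
    simpa using this
  rw [intervalIntegral.integral_of_le hx.le, integral_Ioc_eq_integral_Ioo, ← himage,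
    integral_image_eq_integral_abs_deriv_smul measurableSet_Ioi hderiv hinj, resolvent,
    ← integral_const_mul]
  congr 1
  ext t
  have hpos : 0 < x * Real.exp (-t) := by positivity
  have hne : ((x * Real.exp (-t) : ℝ) : ℂ) ≠ 0 := by exact_mod_cast hpos.ne'
  have h1 : ((x * Real.exp (-t) : ℝ) : ℂ) ^ θ = (x : ℂ) ^ θ * Complex.exp (-θ * t) := by
    rw [Complex.ofReal_mul, Complex.mul_cpow_ofReal_nonneg hx.le (Real.exp_pos _).le]
    congr 1
    rw [Complex.cpow_def_of_ne_zero (by exact_mod_cast (Real.exp_pos _).ne'),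
      ← Complex.ofReal_log (Real.exp_pos _).le, Real.log_exp]
    congr 1
    push_cast
    ring
  rw [abs_neg, abs_of_pos hpos, Complex.cpow_sub _ _ hne, Complex.cpow_one, h1,
    binomPoisson_zero_left, Complex.real_smul]
  have h2 : (Complex.exp x) * ((Real.exp (-(x * (1 - Real.exp (-t)))) : ℝ) : ℂ) =
      Complex.exp ((x * Real.exp (-t) : ℝ) : ℂ) := by
    rw [Complex.ofReal_exp, ← Complex.exp_add]
    congr 1
    push_cast
    ring
  rw [← h2]
  have hx0 : (x : ℂ) ≠ 0 := by exact_mod_cast hx.ne'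
  push_cast at hne ⊢
  field_simp

/-- Continuity in the arrival rate is what pointwise Fourier inversion needs. -/
lemma continuousAt_resolvent {x : ℝ} (hx : 0 < x) {θ : ℂ} (hθ : 0 < θ.re) (n : ℕ) :
    ContinuousAt (fun x : ℝ => resolvent x θ 0 n) x := by
  unfold resolvent
  refine continuousAt_of_dominated (bound := fun t => Real.exp (-θ.re * t)) ?_ ?_
    (integrableOn_exp_mul_Ioi (neg_lt_zero.2 hθ) 0) ?_
  · refine Eventually.of_forall fun y => ?_
    have := continuous_binomPoisson y 0 n
    exact Continuous.aestronglyMeasurable (by fun_prop)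
  · filter_upwards [Ioi_mem_nhds hx] with y hy
    refine (ae_restrict_iff' measurableSet_Ioi).2 (Eventually.of_forall fun t ht => ?_)
    exact norm_exp_mul_binomPoisson_le hy θ 0 n (le_of_lt ht)
  · refine Eventually.of_forall fun t => ?_
    simp only [binomPoisson_zero_left]
    fun_prop

/-! ### Deformation of the loop to a vertical line -/

/-- Cauchy's theorem on the rectangle with opposite corners -R + isε and c + isR. The far horizontal
side is O(1/R) thanks to 1/|Im z|, and the left side is O(Re^{-ρR}). The sign `s` treats both rays
at once. -/
lemma integral_ray_eq_of_tendsto {f : ℂ → ℂ} {ρ C c ε s : ℝ} {L : ℂ} (hρ : 0 < ρ) (hε : 0 < ε)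
    (hs : s = 1 ∨ s = -1) (hd : ∀ z : ℂ, z.im ≠ 0 → DifferentiableAt ℂ f z)
    (hb : ∀ z : ℂ, ε ≤ |z.im| → ‖f z‖ ≤ C * Real.exp (ρ * z.re) / |z.im|)
    (hL : Tendsto (fun R : ℝ => ∫ y : ℝ in (s * ε)..(s * R), f (c + y * Complex.I)) atTop (𝓝 L)) :
    ∫ x : ℝ in Iic c, f (x + (s * ε : ℝ) * Complex.I) = -(Complex.I * L) := by
  have hsabs : |s| = 1 := by rcases hs with rfl | rfl <;> simp
  have hC : 0 ≤ C := by
    have h1 := (norm_nonneg _).trans (hb (ε * Complex.I) (by simp [abs_of_pos hε]))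
    simpa [div_nonneg_iff, hε.ne', abs_of_pos hε, hε.le, not_le.2 hε] using h1
  have him : ∀ R : ℝ, 0 < R → |s * R| = R := fun R hR => by
    rw [abs_mul, hsabs, one_mul, abs_of_pos hR]
  have hcont : ∀ R : ℝ, 0 < R → Continuous fun x : ℝ => f (x + (s * R : ℝ) * Complex.I) := by
    intro R hR
    rw [continuous_iff_continuousAt]
    intro x
    have h1 : ContinuousAt f (x + (s * R : ℝ) * Complex.I) := by
      refine (hd _ ?_).continuousAt
      have := him R hR
      simp only [Complex.add_im, Complex.ofReal_im, Complex.mul_im, Complex.ofReal_re,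
        Complex.I_im, Complex.I_re, mul_one, mul_zero, add_zero, zero_add]
      intro h0
      rw [h0, abs_zero] at this
      exact hR.ne this
    exact ContinuousAt.comp (g := f) (f := fun x : ℝ => (x : ℂ) + (s * R : ℝ) * Complex.I) h1
      (by fun_prop)
  have hbound : ∀ R : ℝ, ε ≤ R → ∀ x : ℝ,
      ‖f (x + (s * R : ℝ) * Complex.I)‖ ≤ C / R * Real.exp (ρ * x) := by
    intro R hR x
    have h1 := him R (hε.trans_le hR)
    have h2 := hb (x + (s * R : ℝ) * Complex.I) (by simpa using hR.trans_eq (by simpa using h1.symm))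
    simp only [Complex.add_im, Complex.ofReal_im, Complex.mul_im, Complex.ofReal_re,
      Complex.I_im, Complex.I_re, mul_one, mul_zero, add_zero, zero_add, Complex.add_re,
      Complex.mul_re, sub_zero, h1] at h2
    refine h2.trans_eq ?_
    ring
  have hexp : IntegrableOn (fun x : ℝ => Real.exp (ρ * x)) (Iic c) :=
    integrableOn_exp_mul_Iic hρ c
  have hint : IntegrableOn (fun x : ℝ => f (x + (s * ε : ℝ) * Complex.I)) (Iic c) :=
    (hexp.const_mul (C / ε)).mono' (hcont ε hε).aestronglyMeasurable
      (Eventually.of_forall fun x => hbound ε le_rfl x)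
  have hlim1 := intervalIntegral_tendsto_integral_Iic c hint tendsto_neg_atTop_atBot
  have hlim2 : Tendsto (fun R : ℝ => ∫ x in (-R)..c, f (x + (s * R : ℝ) * Complex.I)) atTop
      (𝓝 0) := by
    refine squeeze_zero_norm' (a := fun R => C / R * ∫ x in Iic c, Real.exp (ρ * x)) ?_ ?_
    · filter_upwards [eventually_ge_atTop ε, eventually_ge_atTop (-c)] with R hR hRc
      have hle : -R ≤ c := by linarith
      refine (intervalIntegral.norm_integral_le_of_norm_le hle
        (Eventually.of_forall fun x _ => hbound R hR x)
        (Continuous.intervalIntegrable (by fun_prop) _ _)).trans ?_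
      rw [intervalIntegral.integral_const_mul]
      refine mul_le_mul_of_nonneg_left ?_ (div_nonneg hC (hε.le.trans hR))
      rw [intervalIntegral.integral_of_le hle]
      exact setIntegral_mono_set hexp (Eventually.of_forall fun x => (Real.exp_pos _).le)
        Ioc_subset_Iic_self.eventuallyLE
    · have := (tendsto_const_nhds (x := C)).div_atTop tendsto_id
      simpa using this.mul_const (∫ x in Iic c, Real.exp (ρ * x))
  have hmem : ∀ R y : ℝ, ε ≤ R → y ∈ uIcc (s * ε) (s * R) → ε ≤ |y| := by
    intro R y hR hy
    rcases hs with rfl | rfl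
    · rw [one_mul, one_mul, uIcc_of_le hR] at hy
      exact hy.1.trans (le_abs_self y)
    · rw [uIcc_of_ge (by linarith)] at hy
      rw [abs_of_neg (by linarith [hy.2])]
      linarith [hy.2]
  have hlim4 : Tendsto (fun R : ℝ => ∫ y in (s * ε)..(s * R), f ((-R : ℝ) + y * Complex.I)) atTop
      (𝓝 0) := by
    refine squeeze_zero_norm' (a := fun R => C / ε * (R ^ (1 : ℝ) * Real.exp (-ρ * R))) ?_ ?_
    · filter_upwards [eventually_ge_atTop ε] with R hR
      refine (intervalIntegral.norm_integral_le_of_norm_le_const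
        (C := C / ε * Real.exp (-ρ * R)) fun y hy => ?_).trans ?_
      · have h1 := hmem R y hR (uIoc_subset_uIcc hy)
        have h2 := hb ((-R : ℝ) + y * Complex.I) (by simpa using h1)
        simp only [Complex.add_im, Complex.ofReal_im, Complex.mul_im, Complex.ofReal_re,
          Complex.I_im, Complex.I_re, mul_one, mul_zero, add_zero, zero_add, Complex.add_re,
          Complex.mul_re, sub_zero] at h2
        rw [mul_neg, ← neg_mul] at h2
        refine h2.trans ?_
        rw [div_mul_eq_mul_div]
        exact div_le_div_of_nonneg_left (mul_nonneg hC (Real.exp_pos _).le) hε h1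
      · have h3 : |s * R - s * ε| ≤ R := by
          rw [← mul_sub, abs_mul, hsabs, one_mul, abs_of_nonneg (by linarith)]
          linarith
        refine (mul_le_mul_of_nonneg_left h3
          (mul_nonneg (div_nonneg hC hε.le) (Real.exp_pos _).le)).trans_eq ?_
        rw [Real.rpow_one]
        ring
    · simpa using (tendsto_rpow_mul_exp_neg_mul_atTop_nhds_zero 1 ρ hρ).const_mul (C / ε)
  have hrect : ∀ᶠ R : ℝ in atTop,
      (∫ x in (-R)..c, f (x + (s * ε : ℝ) * Complex.I)) -
        (∫ x in (-R)..c, f (x + (s * R : ℝ) * Complex.I)) +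
        Complex.I * (∫ y in (s * ε)..(s * R), f (c + y * Complex.I)) -
        Complex.I * (∫ y in (s * ε)..(s * R), f ((-R : ℝ) + y * Complex.I)) = 0 := by
    filter_upwards [eventually_ge_atTop ε] with R hR
    have h := Complex.integral_boundary_rect_eq_zero_of_differentiableOn f
      ⟨-R, s * ε⟩ ⟨c, s * R⟩ (fun z hz => (hd z fun h0 => ?_).differentiableWithinAt)
    · simpa using h
    · have h1 := hmem R z.im hR hz.2
      rw [h0, abs_zero] at h1
      linarith
  have hlim := ((hlim1.sub hlim2).add (hL.const_mul Complex.I)).sub (hlim4.const_mul Complex.I)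
  have h0 := tendsto_nhds_unique (hlim.congr' hrect) tendsto_const_nhds
  simp only [sub_zero, mul_zero] at h0
  exact eq_neg_of_add_eq_zero_left h0

/-- The two rays swing onto the half-lines of Re z = c above and below the segment, which stays
fixed. Each ray moves inside its own half-plane, so analyticity off the real axis suffices and the
branch cut is never met. -/
lemma loopIntegral_eq_integral_vertical {f : ℂ → ℂ} {ρ C c ε : ℝ} (hρ : 0 < ρ) (hε : 0 < ε)
    (hd : ∀ z : ℂ, z.im ≠ 0 → DifferentiableAt ℂ f z)
    (hb : ∀ z : ℂ, ε ≤ |z.im| → ‖f z‖ ≤ C * Real.exp (ρ * z.re) / |z.im|)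
    (hi : Integrable fun y : ℝ => f (c + y * Complex.I)) :
    loopIntegral c ε f = Complex.I * ∫ y : ℝ, f (c + y * Complex.I) := by
  have h1 := (integral_ray_eq_of_tendsto (s := 1) (c := c)
    (L := ∫ y : ℝ in Ioi ε, f (c + y * Complex.I)) hρ hε (Or.inl rfl) hd hb (by
      simpa using intervalIntegral_tendsto_integral_Ioi ε hi.integrableOn tendsto_id))
  have h2 := (integral_ray_eq_of_tendsto (s := -1) (c := c)
    (L := -∫ y : ℝ in Iic (-ε), f (c + y * Complex.I)) hρ hε (Or.inr rfl) hd hb (by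
      have := (intervalIntegral_tendsto_integral_Iic (-ε) hi.integrableOn
        tendsto_neg_atTop_atBot).neg
      refine this.congr fun R => ?_
      rw [← intervalIntegral.integral_symm]
      simp))
  have h3 : (∫ y : ℝ in Iic (-ε), f (c + y * Complex.I)) +
      (∫ y : ℝ in (-ε)..ε, f (c + y * Complex.I)) + (∫ y : ℝ in Ioi ε, f (c + y * Complex.I)) =
      ∫ y : ℝ, f (c + y * Complex.I) := by
    have h4 := intervalIntegral.integral_Iic_sub_Iic (a := -ε) (b := ε)
      (f := fun y : ℝ => f (c + y * Complex.I)) hi.integrableOn hi.integrableOn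
    rw [← h4, add_sub_cancel]
    exact intervalIntegral.integral_Iic_add_Ioi hi.integrableOn hi.integrableOn
  simp only [one_mul, neg_mul, Complex.ofReal_neg, ← sub_eq_add_neg] at h1 h2
  rw [loopIntegral, h1, h2, ← h3]
  ring

/-! ### The functions `G_n` -/

/-- The integrand of `G`. -/
def kernelG (ρ : ℝ) (θ : ℂ) (n : ℕ) (z : ℂ) : ℂ :=
  Complex.exp (ρ * z) / (z ^ (n + 1) * (z - 1) ^ θ)

lemma differentiableAt_kernelG (ρ : ℝ) (θ : ℂ) (n : ℕ) {z : ℂ} (hz0 : z ≠ 0)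
    (hz : z - 1 ∈ Complex.slitPlane) : DifferentiableAt ℂ (kernelG ρ θ n) z := by
  have h1 : DifferentiableAt ℂ (fun z : ℂ => (z - 1) ^ θ) z :=
    (((hasDerivAt_id z).sub_const 1).cpow_const hz).differentiableAt
  have h2 : z ^ (n + 1) * (z - 1) ^ θ ≠ 0 := mul_ne_zero (pow_ne_zero _ hz0)
    (cpow_ne_zero_of_ne_zero (Complex.slitPlane_ne_zero hz) θ)
  unfold kernelG
  fun_prop (disch := assumption)

lemma inv_norm_cpow_le {w θ : ℂ} (hw : w ≠ 0) (hθ : 0 ≤ θ.re) {d : ℝ} (hd : 0 < d)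
    (hdw : d ≤ ‖w‖) : ‖w ^ θ‖⁻¹ ≤ Real.exp (Real.pi * |θ.im|) / d ^ θ.re := by
  rw [Complex.norm_cpow_of_ne_zero hw, inv_div]
  have h1 : w.arg * θ.im ≤ Real.pi * |θ.im| := by
    refine (le_abs_self _).trans ?_
    rw [abs_mul]
    exact mul_le_mul_of_nonneg_right (Complex.abs_arg_le_pi w) (abs_nonneg _)
  exact div_le_div₀ (Real.exp_pos _).le (Real.exp_le_exp.2 h1) (Real.rpow_pos_of_pos hd _)
    (Real.rpow_le_rpow hd.le hdw hθ)

lemma norm_kernelG_le (ρ : ℝ) {θ : ℂ} (hθ : 0 ≤ θ.re) (n : ℕ) {z : ℂ} {d e : ℝ}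
    (hd : 0 < d) (he : 0 < e) (hdz : d ≤ ‖z - 1‖) (hez : e ≤ ‖z‖ ^ (n + 1)) :
    ‖kernelG ρ θ n z‖ ≤
      Real.exp (ρ * z.re) * (e⁻¹ * (Real.exp (Real.pi * |θ.im|) / d ^ θ.re)) := by
  rw [kernelG, norm_div, norm_mul, norm_pow, Complex.norm_exp, div_eq_mul_inv, mul_inv]
  have h1 : (ρ * z : ℂ).re = ρ * z.re := by simp
  rw [h1]
  refine mul_le_mul_of_nonneg_left ?_ (Real.exp_pos _).le
  exact mul_le_mul (inv_anti₀ he hez)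
    (inv_norm_cpow_le (norm_pos_iff.1 (hd.trans_le hdz)) hθ hd hdz)
    (inv_nonneg.2 (norm_nonneg _)) (inv_nonneg.2 he.le)

/-- One of the n + 1 factors |z| is kept as |Im z| to supply the decay; the others are bounded below
by ε. -/
lemma norm_kernelG_le_of_im (ρ : ℝ) {θ : ℂ} (hθ : 0 ≤ θ.re) (n : ℕ) {ε : ℝ} (hε : 0 < ε) {z : ℂ}
    (hz : ε ≤ |z.im|) :
    ‖kernelG ρ θ n z‖ ≤ ((ε ^ n)⁻¹ * (Real.exp (Real.pi * |θ.im|) / ε ^ θ.re)) *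
      Real.exp (ρ * z.re) / |z.im| := by
  have h1 : |z.im| ≤ ‖z - 1‖ := by simpa using Complex.abs_im_le_norm (z - 1)
  have h2 : ε ^ n * |z.im| ≤ ‖z‖ ^ (n + 1) := by
    have h3 := Complex.abs_im_le_norm z
    rw [pow_succ]
    exact mul_le_mul (pow_le_pow_left₀ hε.le (hz.trans h3) n) h3 (abs_nonneg _) (by positivity)
  refine (norm_kernelG_le ρ hθ n hε (mul_pos (pow_pos hε n) (hε.trans_le hz)) (hz.trans h1)
    h2).trans_eq ?_
  rw [mul_inv]
  ring

lemma one_add_abs_le_norm {a b : ℝ} (ha : b ≤ a) (y : ℝ) :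
    min b 1 / 2 * (1 + |y|) ≤ ‖(a + y * Complex.I : ℂ)‖ := by
  have h1 : a ≤ ‖(a + y * Complex.I : ℂ)‖ := by
    simpa using Complex.re_le_norm (a + y * Complex.I : ℂ)
  have h2 : |y| ≤ ‖(a + y * Complex.I : ℂ)‖ := by
    simpa using Complex.abs_im_le_norm (a + y * Complex.I : ℂ)
  have h3 := min_le_left b 1
  have h4 : min b 1 * |y| ≤ 1 * |y| :=
    mul_le_mul_of_nonneg_right (min_le_right b 1) (abs_nonneg y)
  linarith

/-- The integrand is O((1 + |y|)^{-1-Re θ}); a single factor |z| is enough, since |z| ≥ 1 on the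
line. No sign of `ρ` is imposed, and the value 0 is used in the inversion below. -/
lemma integrable_kernelG (ρ : ℝ) {θ : ℂ} (hθ : 0 < θ.re) (n : ℕ) {c : ℝ} (hc : 1 < c) :
    Integrable fun y : ℝ => kernelG ρ θ n (c + y * Complex.I) := by
  have hc1 : 0 < c - 1 := sub_pos.2 hc
  set κ := min (c - 1) 1 / 2
  have hκ : 0 < κ := by positivity
  have hbase : Integrable fun y : ℝ => (1 + ‖y‖) ^ (-(1 + θ.re)) :=
    integrable_one_add_norm (by simpa using hθ)
  have hsub : ∀ y : ℝ, (c + y * Complex.I : ℂ) - 1 = (c - 1 : ℝ) + y * Complex.I := fun y => by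
    push_cast
    ring
  refine (hbase.const_mul (Real.exp (ρ * c) *
    (κ⁻¹ * (Real.exp (Real.pi * |θ.im|) / κ ^ θ.re)))).mono' ?_ ?_
  · refine Continuous.aestronglyMeasurable (continuous_iff_continuousAt.2 fun y => ?_)
    have h1 : ContinuousAt (kernelG ρ θ n) (c + y * Complex.I) := by
      refine (differentiableAt_kernelG ρ θ n ?_ (Or.inl ?_)).continuousAt
      · intro h
        have := congrArg Complex.re h
        simp at this
        linarith
      · simpa using hc
    exact ContinuousAt.comp (g := kernelG ρ θ n) (f := fun y : ℝ => (c : ℂ) + y * Complex.I) h1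
      (by fun_prop)
  · refine Eventually.of_forall fun y => ?_
    have hpos : 0 < κ * (1 + |y|) := by positivity
    have h1 : κ * (1 + |y|) ≤ ‖(c + y * Complex.I : ℂ) - 1‖ := by
      rw [hsub]
      exact one_add_abs_le_norm le_rfl y
    have h2 : κ * (1 + |y|) ≤ ‖(c + y * Complex.I : ℂ)‖ :=
      one_add_abs_le_norm (by linarith) y
    have h3 : 1 ≤ ‖(c + y * Complex.I : ℂ)‖ := by
      refine hc.le.trans ?_
      simpa using Complex.re_le_norm (c + y * Complex.I : ℂ)
    have h4 : κ * (1 + |y|) ≤ ‖(c + y * Complex.I : ℂ)‖ ^ (n + 1) :=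
      h2.trans (le_self_pow₀ h3 n.succ_ne_zero)
    refine (norm_kernelG_le ρ hθ.le n hpos hpos h1 h4).trans_eq ?_
    have h5 : (0 : ℝ) < 1 + |y| := by positivity
    rw [Real.norm_eq_abs, Real.mul_rpow hκ.le h5.le, Real.rpow_neg h5.le, Real.rpow_add h5,
      Real.rpow_one]
    simp only [Complex.add_re, Complex.ofReal_re, Complex.mul_re, Complex.I_re, mul_zero,
      Complex.ofReal_im, Complex.I_im, mul_one, sub_zero, add_zero]
    field_simp

lemma G_eq_integral_vertical {ρ : ℝ} (hρ : 0 < ρ) {θ : ℂ} (hθ : 0 < θ.re) (n : ℕ) {c ε : ℝ}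
    (hc : 1 < c) (hε : 0 < ε) :
    G ρ c ε n θ = (2 * Real.pi : ℂ)⁻¹ * ∫ y : ℝ, kernelG ρ θ n (c + y * Complex.I) := by
  have hd : ∀ z : ℂ, z.im ≠ 0 → DifferentiableAt ℂ (kernelG ρ θ n) z := by
    intro z hz
    refine differentiableAt_kernelG ρ θ n ?_ (Or.inr ?_)
    · rintro rfl
      exact hz rfl
    · simpa using hz
  have h := loopIntegral_eq_integral_vertical hρ hε hd
    (fun z hz => norm_kernelG_le_of_im ρ hθ.le n hε hz) (integrable_kernelG ρ hθ n hc)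
  change (2 * Real.pi * Complex.I)⁻¹ * loopIntegral c ε (kernelG ρ θ n) = _
  rw [h]
  have := Complex.I_ne_zero
  field_simp

lemma integral_pow_div_factorial_mul_exp (n : ℕ) {z : ℂ} (hz : 0 < z.re) :
    IntegrableOn (fun t : ℝ => (t : ℂ) ^ n / n.factorial * Complex.exp (-(z * t))) (Ioi 0) ∧
    ∫ t : ℝ in Ioi 0, (t : ℂ) ^ n / n.factorial * Complex.exp (-(z * t)) =
      (z ^ (n + 1))⁻¹ := by
  have ha : 0 < ((n + 1 : ℕ) : ℂ).re := by
    rw [Complex.natCast_re]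
    positivity
  have e : ∀ t : ℝ, (t : ℂ) ^ n / n.factorial * Complex.exp (-(z * t)) =
      (n.factorial : ℂ)⁻¹ * ((t : ℂ) ^ (((n + 1 : ℕ) : ℂ) - 1) * Complex.exp (-(z * t))) := by
    intro t
    rw [Nat.cast_succ, add_sub_cancel_right, Complex.cpow_natCast]
    ring
  have hf : (n.factorial : ℂ) ≠ 0 := by exact_mod_cast n.factorial_ne_zero
  simp only [e]
  refine ⟨(integrableOn_cpow_mul_exp_neg_mul ha hz).const_mul _, ?_⟩
  rw [integral_const_mul, integral_cpow_mul_exp_neg_mul ha hz, Complex.cpow_natCast,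
    Nat.cast_succ, Complex.Gamma_nat_eq_factorial]
  field_simp

open FourierTransform in
-- The left side is a convolution in ρ. Damped by e^{-cρ} it is integrable, and its Fourier
-- transform at w is the product of the two Laplace transforms at z = c + 2πiw. Inversion recovers
-- it at the point ρ.
lemma resolvent_zero_left {ρ : ℝ} (hρ : 0 < ρ) {θ : ℂ} (hθ : 0 < θ.re) (n : ℕ) {c : ℝ}
    (hc : 1 < c) :
    (ρ : ℂ) ^ θ * Complex.exp ρ * resolvent ρ θ 0 n =
      Complex.Gamma θ *
        ((2 * Real.pi : ℂ)⁻¹ * ∫ y : ℝ, kernelG ρ θ n (c + y * Complex.I)) := by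
  -- `A z` and `B z` are the two convolution factors, each already multiplied by e^{-zt}.
  set A : ℂ → ℝ → ℂ := fun z t => (t : ℂ) ^ (θ - 1) * Complex.exp (-((z - 1) * t))
  set B : ℂ → ℝ → ℂ := fun z t => (t : ℂ) ^ n / n.factorial * Complex.exp (-(z * t))
  have hA : ∀ z : ℂ, 1 < z.re → IntegrableOn (A z) (Ioi 0) ∧
      ∫ t in Ioi 0, A z t = Complex.Gamma θ / (z - 1) ^ θ := fun z hz => by
    have h : 0 < (z - 1).re := by simpa using hz
    exact ⟨integrableOn_cpow_mul_exp_neg_mul hθ h, integral_cpow_mul_exp_neg_mul hθ h⟩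
  have hB : ∀ z : ℂ, 1 < z.re → IntegrableOn (B z) (Ioi 0) ∧
      ∫ t in Ioi 0, B z t = (z ^ (n + 1))⁻¹ := fun z hz =>
    integral_pow_div_factorial_mul_exp n (zero_lt_one.trans hz)
  have hcre : 1 < (c : ℂ).re := hc
  set K : ℝ → ℂ := posConvolution (A c) (B c) (ContinuousLinearMap.mul ℝ ℂ)
  have hKint : Integrable K := integrable_posConvolution (hA c hcre).1 (hB c hcre).1 _
  have hKpos : ∀ x : ℝ, 0 < x →
      K x = Complex.exp (-(c * x)) * ((x : ℂ) ^ θ * Complex.exp x * resolvent x θ 0 n) := by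
    intro x hx
    rw [← integral_cpow_mul_pow_mul_exp hx, ← intervalIntegral.integral_const_mul]
    simp only [K, posConvolution, indicator_of_mem (mem_Ioi.2 hx), ContinuousLinearMap.mul_apply']
    congr 1
    ext t
    simp only [A, B]
    have : Complex.exp (-(c * x)) * Complex.exp t =
        Complex.exp (-((c - 1) * t)) * Complex.exp (-(c * ((x - t : ℝ) : ℂ))) := by
      rw [← Complex.exp_add, ← Complex.exp_add]
      congr 1
      push_cast
      ring
    push_cast at this ⊢
    linear_combination -((t : ℂ) ^ (θ - 1) * (x - t) ^ n / n.factorial) * this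
  -- `kernelG` with parameter 0 is the bare product of powers; the inversion formula later restores
  -- e^{ρz}.
  have hF : ∀ w : ℝ, 𝓕 K w =
      Complex.Gamma θ * kernelG 0 θ n (c + ((2 * Real.pi * w : ℝ) : ℂ) * Complex.I) := by
    intro w
    set z : ℂ := c + ((2 * Real.pi * w : ℝ) : ℂ) * Complex.I
    have hz : 1 < z.re := by simpa [z] using hc
    have hconv := integral_posConvolution (hA z hz).1 (hB z hz).1 (ContinuousLinearMap.mul ℝ ℂ)
    rw [(hA z hz).2, (hB z hz).2] at hconv
    rw [Real.fourier_real_eq_integral_exp_smul]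
    have hind : ∀ v : ℝ, Complex.exp (↑(-2 * Real.pi * v * w) * Complex.I) • K v =
        indicator (Ioi 0) (fun x => ∫ t in (0 : ℝ)..x,
          ContinuousLinearMap.mul ℝ ℂ (A z t) (B z (x - t))) v := by
      intro v
      by_cases hv : v ∈ Ioi (0 : ℝ)
      · simp only [K, posConvolution, indicator_of_mem hv, smul_eq_mul]
        rw [← intervalIntegral.integral_const_mul]
        congr 1
        ext t
        simp only [A, B, ContinuousLinearMap.mul_apply']
        have : Complex.exp (↑(-2 * Real.pi * v * w) * Complex.I) *
            (Complex.exp (-((c - 1) * t)) * Complex.exp (-(c * ((v - t : ℝ) : ℂ)))) =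
            Complex.exp (-((z - 1) * t)) * Complex.exp (-(z * ((v - t : ℝ) : ℂ))) := by
          simp only [← Complex.exp_add, z]
          congr 1
          push_cast
          ring
        linear_combination ((t : ℂ) ^ (θ - 1) * ((v - t : ℝ) : ℂ) ^ n / n.factorial) * this
      · simp only [K, posConvolution, indicator_of_notMem hv, smul_zero]
    simp only [hind]
    rw [integral_indicator measurableSet_Ioi, hconv, kernelG, ContinuousLinearMap.mul_apply']
    simp only [Complex.ofReal_zero, zero_mul, Complex.exp_zero]
    rw [one_div, mul_inv, div_eq_mul_inv]
    ring
  have hFint : Integrable (𝓕 K) := by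
    rw [show 𝓕 K = fun w => _ from funext hF]
    exact ((integrable_kernelG 0 hθ n hc).comp_mul_left' (R := 2 * Real.pi)
      (by positivity)).const_mul _
  have hKcont : ContinuousAt K ρ := by
    have h1 : ContinuousAt (fun x : ℝ => Complex.exp (-(c * x)) *
        ((x : ℂ) ^ θ * Complex.exp x * resolvent x θ 0 n)) ρ := by
      have h2 := continuousAt_resolvent hρ hθ n
      have h3 := Complex.continuousAt_ofReal_cpow_const ρ θ (Or.inr hρ.ne')
      have h4 : ContinuousAt (fun x : ℝ => Complex.exp (-(c * x))) ρ := by fun_prop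
      have h5 : ContinuousAt (fun x : ℝ => Complex.exp x) ρ := by fun_prop
      exact h4.mul ((h3.mul h5).mul h2)
    refine h1.congr ?_
    filter_upwards [Ioi_mem_nhds hρ] with x hx using (hKpos x hx).symm
  have hinv := hKint.fourierInv_fourier_eq hFint hKcont
  rw [hKpos ρ hρ, Real.fourierInv_eq'] at hinv
  simp only [hF, smul_eq_mul] at hinv
  have hexp : ∀ w : ℝ, Complex.exp (↑(2 * Real.pi * inner ℝ w ρ) * Complex.I) *
      (Complex.Gamma θ * kernelG 0 θ n (c + ((2 * Real.pi * w : ℝ) : ℂ) * Complex.I)) =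
      Complex.exp (-(c * ρ)) * (Complex.Gamma θ *
        kernelG ρ θ n (c + ((2 * Real.pi * w : ℝ) : ℂ) * Complex.I)) := by
    intro w
    simp only [kernelG, Complex.ofReal_zero, zero_mul, Complex.exp_zero]
    have : Complex.exp (↑(2 * Real.pi * inner ℝ w ρ) * Complex.I) = Complex.exp (-(c * ρ)) *
        Complex.exp (ρ * (c + ((2 * Real.pi * w : ℝ) : ℂ) * Complex.I)) := by
      rw [← Complex.exp_add]
      congr 1
      simp only [RCLike.inner_apply, conj_trivial]
      push_cast
      ring
    rw [this]
    ring
  simp only [hexp] at hinv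
  rw [integral_const_mul, integral_const_mul] at hinv
  -- Rescaling y = 2πw produces the factor 1/(2π).
  have hscale := Measure.integral_comp_mul_left
    (fun y : ℝ => kernelG ρ θ n (c + (y : ℂ) * Complex.I)) (2 * Real.pi)
  rw [hscale] at hinv
  have h := mul_left_cancel₀ (Complex.exp_ne_zero _) hinv
  rw [← h, abs_of_pos (by positivity), Complex.real_smul]
  push_cast
  rfl

lemma resolvent_zero_left_eq_G {ρ : ℝ} (hρ : 0 < ρ) {θ : ℂ} (hθ : 0 < θ.re) (n : ℕ) {c ε : ℝ}
    (hc : 1 < c) (hε : 0 < ε) :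
    resolvent ρ θ 0 n = Complex.Gamma θ * Complex.exp (-ρ) / (ρ : ℂ) ^ θ * G ρ c ε n θ := by
  have h := resolvent_zero_left hρ hθ n hc
  rw [← G_eq_integral_vertical hρ hθ n hc hε] at h
  have h1 := cpow_ne_zero_of_ne_zero (z := (ρ : ℂ)) (by exact_mod_cast hρ.ne') θ
  have h2 := Complex.exp_ne_zero (ρ : ℂ)
  rw [Complex.exp_neg]
  field_simp
  linear_combination h

end ErlangA

end

/-! ### Assembly of the four assertions -/

theorem corollary2 {Ω : Type*} [MeasurableSpace Ω] (μ : MeasureTheory.Measure Ω)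
    [MeasureTheory.IsProbabilityMeasure μ] (m : ℕ) (ρ : ℝ) (hρ : 0 < ρ) (N : ℝ≥0 → Ω → ℕ)
    (hN : ErlangA.IsErlangA μ m 1 ρ N) (n₀ : ℕ) (hn₀ : μ {ω | N 0 ω = n₀} ≠ 0)
    (r : ℝ) (hr₀ : 0 < r) (hr₁ : r < 1) (c ε : ℝ) (hc : 1 < c) (hε : 0 < ε) :
    -- the Laplace transform
    (∀ (n : ℕ) (θ : ℂ), 0 < θ.re →
      MeasureTheory.IntegrableOn
        (fun t : ℝ => Complex.exp (-θ * t) * (ErlangA.p μ N n₀ n t : ℂ)) (Set.Ioi 0) ∧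
      (n₀ ≤ n →
        ∫ t : ℝ in Set.Ioi 0, Complex.exp (-θ * t) * (ErlangA.p μ N n₀ n t : ℂ) =
          Complex.Gamma θ * (n₀.factorial : ℂ) * Complex.exp (-ρ) / (ρ : ℂ) ^ ((n₀ : ℂ) + θ) *
            (ErlangA.F ρ r n₀ θ * ErlangA.G ρ c ε n θ)) ∧
      (n ≤ n₀ →
        ∫ t : ℝ in Set.Ioi 0, Complex.exp (-θ * t) * (ErlangA.p μ N n₀ n t : ℂ) =
          Complex.Gamma θ * (n₀.factorial : ℂ) * Complex.exp (-ρ) / (ρ : ℂ) ^ ((n₀ : ℂ) + θ) *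
            (ErlangA.G ρ c ε n₀ θ * ErlangA.F ρ r n θ))) ∧
    -- the spectral representation
    (∀ (n : ℕ) (t : ℝ), 0 ≤ t →
      HasSum
        (fun k : ℕ => (n₀.factorial : ℂ) * Complex.exp (-ρ) / (ρ : ℂ) ^ n₀ *
          ((ρ : ℂ) ^ k / (k.factorial : ℂ) * Complex.exp (-(k * t)) *
            ErlangA.F ρ r n₀ (-k) * ErlangA.F ρ r n (-k)))
        (ErlangA.p μ N n₀ n t : ℂ)) ∧
    (∀ n k : ℕ,
      ErlangA.F ρ r n (-k) =
        (2 * Real.pi * Complex.I)⁻¹ *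
          ∮ z in C(0, r), (1 - z) ^ k / z ^ (n + 1) * Complex.exp (ρ * z) ∧
      ErlangA.F ρ r n (-k) =
        ∑ j ∈ Finset.range (min k n + 1),
          (k.choose j : ℂ) * (-1) ^ j * ((ρ : ℂ) ^ (n - j) / ((n - j).factorial : ℂ))) ∧
    -- the binomial-Poisson form
    (∀ (n : ℕ) (t : ℝ), 0 ≤ t →
      ErlangA.p μ N n₀ n t =
        ρ ^ n * Real.exp (-ρ * (1 - Real.exp (-t))) *
          ∑ j ∈ Finset.range (min n n₀ + 1),
            (n₀.choose j : ℝ) * (ρ ^ j)⁻¹ * Real.exp (-(j * t)) *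
              (1 - Real.exp (-t)) ^ (n + n₀ - 2 * j) * (1 / ((n - j).factorial : ℝ))) ∧
    -- the limit distribution
    (∀ n : ℕ,
      Filter.Tendsto (ErlangA.p μ N n₀ n) Filter.atTop
        (𝓝 (Real.exp (-ρ) * ρ ^ n / (n.factorial : ℝ)))) := by
  have hp := fun n {t : ℝ} (ht : 0 ≤ t) => ErlangA.p_eq_binomPoisson hρ hN hn₀ n ht
  have hρ' : (ρ : ℂ) ≠ 0 := by exact_mod_cast hρ.ne'
  refine ⟨fun n θ hθ => ?_, fun n t ht => ?_, fun n k => ⟨?_, ?_⟩, fun n t ht => ?_, fun n => ?_⟩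
  · have hcongr : ∀ t ∈ Set.Ioi (0 : ℝ),
        Complex.exp (-θ * t) * (ErlangA.binomPoisson ρ (Real.exp (-t)) n₀ n : ℂ) =
          Complex.exp (-θ * t) * (ErlangA.p μ N n₀ n t : ℂ) := fun t ht => by
      rw [hp n (le_of_lt ht)]
    have hint : ∫ t : ℝ in Set.Ioi 0, Complex.exp (-θ * t) * (ErlangA.p μ N n₀ n t : ℂ) =
        ErlangA.resolvent ρ θ n₀ n :=
      (MeasureTheory.setIntegral_congr_fun measurableSet_Ioi hcongr).symm
    have hpow : (ρ : ℂ) ^ ((n₀ : ℂ) + θ) = (ρ : ℂ) ^ n₀ * (ρ : ℂ) ^ θ := by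
      rw [Complex.cpow_add _ _ hρ', Complex.cpow_natCast]
    rw [hint, hpow]
    refine ⟨(ErlangA.integrableOn_resolvent hρ hθ n₀ n).congr_fun hcongr measurableSet_Ioi,
      fun h => ?_, fun h => ?_⟩
    · rw [ErlangA.resolvent_eq_of_le hρ hθ hr₀ hr₁ h,
        ErlangA.resolvent_zero_left_eq_G hρ hθ n hc hε]
      ring
    · have hf : (n.factorial : ℂ) ≠ 0 := by exact_mod_cast n.factorial_ne_zero
      have hf₀ : (n₀.factorial : ℂ) ≠ 0 := by exact_mod_cast n₀.factorial_ne_zero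
      -- Detailed balance exchanges initial and target state, which reduces this case to the ordered
      -- one.
      have hsymm := ErlangA.resolvent_symm ρ θ n₀ n
      rw [ErlangA.resolvent_eq_of_le hρ hθ hr₀ hr₁ h,
        ErlangA.resolvent_zero_left_eq_G hρ hθ n₀ hc hε] at hsymm
      have hc₀ : (ρ : ℂ) ^ n₀ / n₀.factorial ≠ 0 := div_ne_zero (pow_ne_zero _ hρ') hf₀
      refine mul_left_cancel₀ hc₀ (hsymm.trans ?_)
      field_simp
  · simp only [ErlangA.F_neg_natCast ρ _ _ hr₀ hr₁]
    rw [hp n ht]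
    have h := (ErlangA.hasSum_charlier ρ (Real.exp (-t)) n₀ n).mul_left
      (n₀.factorial * Real.exp (-ρ) / ρ ^ n₀)
    have hval : n₀.factorial * Real.exp (-ρ) / ρ ^ n₀ * (ρ ^ n₀ / n₀.factorial * Real.exp ρ *
        ErlangA.binomPoisson ρ (Real.exp (-t)) n₀ n) =
        ErlangA.binomPoisson ρ (Real.exp (-t)) n₀ n := by
      have hf₀ : (n₀.factorial : ℝ) ≠ 0 := by exact_mod_cast n₀.factorial_ne_zero
      rw [Real.exp_neg]
      field_simp
    rw [hval] at h
    refine (Complex.hasSum_ofReal.2 h).congr_fun fun k => ?_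
    have hexp : Complex.exp (-(k * t)) = Complex.exp (-t) ^ k := by
      rw [← Complex.exp_nat_mul]
      ring_nf
    rw [hexp]
    push_cast
    ring
  · rw [ErlangA.F_eq]
    simp only [ErlangA.kernelF_neg_natCast]
  · rw [ErlangA.F_neg_natCast ρ k n hr₀ hr₁, ErlangA.charlier_eq_sum]
    push_cast
    rfl
  · rw [hp n ht, ErlangA.binomPoisson_exp_eq_sum hρ]
  · refine (ErlangA.tendsto_binomPoisson_exp ρ n₀ n).congr' ?_
    filter_upwards [Filter.eventually_ge_atTop 0] with t ht using (hp n ht).symm
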